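/- All digraphs are finite and simple (no loops, no multiple arcs; two opposite arcs are allowed). For a digraph $D$ with adjacency matrix $A$, a real number $\lambda$ is a \emph{complementarity eigenvalue} of $D$ if there is a nonzero, entrywise nonnegative vector $x$ with $Ax\ge\lambda x$ entrywise and $\langle x, Ax-\lambda x\rangle=0$. Subdigraphs need not be induced, and types of digraphs are understood up to isomorphism. $\vec C_n$ denotes the directed cycle $1\to2\to\cdots\to n\to1$. An \emph{$\infty$-digraph} consists of two directed cycles (each with at least two vertices) that share exactly one vertex. A \emph{$\theta$-digraph} $\theta(a,b,c)$, with $0\le a\le b$, $b>0$, $c\ge0$, consists of two directed paths from a vertex $w$ to a vertex $v\neq w$, with $a$ and $b$ inner vertices, and a directed path from $v$ to $w$ with $c$ inner vertices, where no two of the three paths have a common inner vertex. A \emph{Type 3 digraph} is $\vec C_n\cup\{(1,i),(i-1,j)\}$ with $2<i<j\le n$. A \emph{Type 4 digraph} is $\vec C_n\cup\{(x_1,y_1),\dots,(x_k,y_k)\}$ with $k\ge2$ and $1\le y_1<x_1<y_2<x_2<\cdots<y_k<x_k\le n$. A \emph{Type 5 digraph} is $\vec C_n\cup\{(1,i),(i-1,j),(j-1,2)\}$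 with $3<i<i+1<j\le n$. \textbf{Theorem.} Let $D$ be a strongly connected digraph with exactly three complementarity eigenvalues that contains a $\theta$-digraph but no $\infty$-digraph as a subdigraph. Then $D$ is a $\theta$-digraph, a Type 3 digraph, a Type 4 digraph or a Type 5 digraph. -/

import Mathlib

/-! Complementarity spectrum of a matrix -/

/-- The complementarity eigenvalues of a real square matrix `A`: the reals `t` for which some
nonzero, entrywise nonnegative vector `x` satisfies `A x ≥ t x` and `⟨x, A x - t x⟩ = 0`. -/
def Matrix.complementaritySpectrum {V : Type*} [Fintype V] (A : Matrix V V ℝ) : Set ℝ :=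
  {t : ℝ | ∃ x : V → ℝ, x ≠ 0 ∧ (∀ i, 0 ≤ x i) ∧ (∀ i, t * x i ≤ (A.mulVec x) i) ∧
    x ⬝ᵥ (A.mulVec x - t • x) = 0}

namespace Digraph

open Classical in
/-- The 0-1 adjacency matrix of a digraph. -/
noncomputable def adjMatrix {V : Type*} (D : Digraph V) : Matrix V V ℝ :=
  Matrix.of fun x y => if D.Adj x y then 1 else 0

/-- The complementarity spectrum of a digraph. -/
noncomputable def complementaritySpectrum {V : Type*} [Fintype V] (D : Digraph V) : Set ℝ :=
  D.adjMatrix.complementaritySpectrum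

/-- A digraph in the sense of `Digraph` never has multiple arcs; it is simple if it has no loops.
Two opposite arcs between two vertices are allowed. -/
def IsSimple {V : Type*} (D : Digraph V) : Prop :=
  ∀ x, ¬ D.Adj x x

/-- Every vertex can be reached from every vertex by a directed walk. -/
def StronglyConnected {V : Type*} (D : Digraph V) : Prop :=
  ∀ x y, Relation.ReflTransGen D.Adj x y

/-- `(x, y)` is one of the arcs `(p 0, p 1), (p 1, p 2), …` of the path `p`. -/
def IsPathArc {V : Type*} {m : ℕ} (p : Fin m → V) (x y : V) : Prop :=
  ∃ i j : Fin m, (j : ℕ) = i + 1 ∧ p i = x ∧ p j = y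

/-- `(x, y)` is one of the arcs `(p 0, p 1), …, (p (m - 1), p 0)` of the cycle `p`. -/
def IsCycleArc {V : Type*} {m : ℕ} (p : Fin m → V) (x y : V) : Prop :=
  ∃ i j : Fin m, (j : ℕ) = (i + 1) % m ∧ p i = x ∧ p j = y

/-- `D` is the coalescence `∞(r, s)` of a directed cycle on `r` vertices and a directed cycle
on `s` vertices: they share exactly one vertex, and `D` has no other vertices or arcs. -/
def IsInfinityDigraph {V : Type*} (D : Digraph V) : Prop :=
  ∃ (r s : ℕ) (hr : 2 ≤ r) (hs : 2 ≤ s) (p : Fin r → V) (q : Fin s → V),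
    Function.Injective p ∧ Function.Injective q ∧
    (∀ i j, p i = q j ↔ i = ⟨0, by omega⟩ ∧ j = ⟨0, by omega⟩) ∧
    (∀ x, x ∈ Set.range p ∪ Set.range q) ∧
    (∀ x y, D.Adj x y ↔ IsCycleArc p x y ∨ IsCycleArc q x y)

/-- `D` is a digraph `θ(a, b, c)` with `a ≤ b` and `0 < b`: it consists of directed paths `p`
and `q` from `w` to `v`, with `a` and `b` inner vertices, and a directed path `r` from `v` to `w`
with `c` inner vertices; these paths have no common vertices besides `v` and `w`. -/
def IsThetaDigraph {V : Type*} (D : Digraph V) : Prop :=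
  ∃ (a b c : ℕ) (p : Fin (a + 2) → V) (q : Fin (b + 2) → V) (r : Fin (c + 2) → V),
    a ≤ b ∧ 0 < b ∧
    Function.Injective p ∧ Function.Injective q ∧ Function.Injective r ∧
    (∀ i j, p i = q j ↔ (i = 0 ∧ j = 0) ∨ (i = Fin.last _ ∧ j = Fin.last _)) ∧
    (∀ i j, p i = r j ↔ (i = 0 ∧ j = Fin.last _) ∨ (i = Fin.last _ ∧ j = 0)) ∧
    (∀ i j, q i = r j ↔ (i = 0 ∧ j = Fin.last _) ∨ (i = Fin.last _ ∧ j = 0)) ∧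
    (∀ x, x ∈ Set.range p ∪ Set.range q ∪ Set.range r) ∧
    (∀ x y, D.Adj x y ↔ IsPathArc p x y ∨ IsPathArc q x y ∨ IsPathArc r x y)

/-- `H`, with vertex set `s`, is a (not necessarily induced) subdigraph of `D`. -/
def IsSubdigraph {V : Type*} {s : Set V} (H : Digraph s) (D : Digraph V) : Prop :=
  ∀ x y : s, H.Adj x y → D.Adj x y

/-- Some subdigraph of `D` is an ∞-digraph. -/
def HasInfinitySubdigraph {V : Type*} (D : Digraph V) : Prop :=
  ∃ (s : Set V) (H : Digraph s), H.IsSubdigraph D ∧ H.IsInfinityDigraph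

/-- Some subdigraph of `D` is a θ-digraph. -/
def HasThetaSubdigraph {V : Type*} (D : Digraph V) : Prop :=
  ∃ (s : Set V) (H : Digraph s), H.IsSubdigraph D ∧ H.IsThetaDigraph

/-- The directed cycle `1 → 2 → ⋯ → n → 1` together with the arcs in `E`, which are given by
labels in `{1, …, n}`; the vertex `x : Fin n` carries the label `x + 1`. -/
def cycleWithArcs (n : ℕ) (E : Set (ℕ × ℕ)) : Digraph (Fin n) where
  Adj x y := (y : ℕ) = (x + 1) % n ∨ ((x : ℕ) + 1, (y : ℕ) + 1) ∈ E

/-- Isomorphism of digraphs. -/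
def Isomorphic {V W : Type*} (D : Digraph V) (H : Digraph W) : Prop :=
  Nonempty (D.Adj ≃r H.Adj)

/-- Type 3: a directed `n`-cycle with the arcs `(1, i)` and `(i - 1, j)`. -/
def IsType3 {V : Type*} (D : Digraph V) : Prop :=
  ∃ n i j : ℕ, 2 < i ∧ i < j ∧ j ≤ n ∧
    D.Isomorphic (cycleWithArcs n {(1, i), (i - 1, j)})

/-- Type 4: a directed `n`-cycle with `k ≥ 2` arcs `(x₁, y₁), …, (x_k, y_k)`, where
`1 ≤ y₁ < x₁ < y₂ < x₂ < ⋯ < y_k < x_k ≤ n`. -/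
def IsType4 {V : Type*} (D : Digraph V) : Prop :=
  ∃ (n k : ℕ) (x y : ℕ → ℕ), 2 ≤ k ∧ 1 ≤ y 1 ∧ x k ≤ n ∧
    (∀ i ∈ Finset.Icc 1 k, y i < x i) ∧
    (∀ i ∈ Finset.Ico 1 k, x i < y (i + 1)) ∧
    D.Isomorphic (cycleWithArcs n {e | ∃ i ∈ Finset.Icc 1 k, e = (x i, y i)})

/-- Type 5: a directed `n`-cycle with the arcs `(1, i)`, `(i - 1, j)` and `(j - 1, 2)`. -/
def IsType5 {V : Type*} (D : Digraph V) : Prop :=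
  ∃ n i j : ℕ, 3 < i ∧ i + 1 < j ∧ j ≤ n ∧
    D.Isomorphic (cycleWithArcs n {(1, i), (i - 1, j), (j - 1, 2)})

end Digraph

/-!
The number `0` is a complementarity eigenvalue of a digraph without loops, `1` is one of a digraph
containing an induced directed cycle, and by Perron–Frobenius so is the spectral radius of every
strongly connected induced subdigraph. That radius exceeds `1` as soon as some vertex has two
out-neighbours, and it strictly decreases from `D` to a proper induced subdigraph. Hence three
eigenvalues force `D` to be branch critical: no proper strongly connected induced subdigraph has a
vertex with two out-neighbours.

A shortest directed cycle is induced, and together with a shortest ear it is strongly connected and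
has such a vertex, so the two contain all vertices. Criticality applied to the ear followed by a
segment of the cycle leaves at most two arcs into and at most two arcs out of the ear, and it keeps
the backward arcs within the ear disjoint. If the ear returns to the cycle one step after some
vertex from which it is entered, the ear and the cycle form a Hamiltonian cycle and the remaining
arcs are its chords; otherwise the ear turns the cycle into a θ-digraph.
-/

section PerronFrobenius

open scoped Matrix

variable {n : Type*} [Fintype n] {A : Matrix n n ℝ} {t ρ : ℝ} {y : n → ℝ}

/-- A nonzero nonnegative vector `y` with `A y ≥ t y`. The largest `t` admitting one is the
Collatz–Wielandt description of the spectral radius of a nonnegative matrix. -/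
structure IsSubeigenvector (A : Matrix n n ℝ) (t : ℝ) (y : n → ℝ) : Prop where
  nonneg : 0 ≤ y
  ne_zero : y ≠ 0
  smul_le : t • y ≤ A *ᵥ y

/-- The Collatz–Wielandt set of `A`: the `t` for which `A` has a subeigenvector. -/
def subeigenvalues (A : Matrix n n ℝ) : Set ℝ :=
  {t | ∃ y, IsSubeigenvector A t y}

theorem IsSubeigenvector.smul (h : IsSubeigenvector A t y) {r : ℝ} (hr : 0 < r) :
    IsSubeigenvector A t (r • y) where
  nonneg := smul_nonneg hr.le h.nonneg
  ne_zero := smul_ne_zero hr.ne' h.ne_zero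
  smul_le := by
    rw [Matrix.mulVec_smul, smul_comm]
    exact smul_le_smul_of_nonneg_left h.smul_le hr.le

theorem IsSubeigenvector.exists_mem_stdSimplex (h : IsSubeigenvector A t y) :
    ∃ x ∈ stdSimplex ℝ n, t • x ≤ A *ᵥ x := by
  have hsum : 0 < ∑ i, y i := by
    obtain ⟨i, hi⟩ := Function.ne_iff.1 h.ne_zero
    exact Finset.sum_pos' (fun i _ => h.nonneg i)
      ⟨i, Finset.mem_univ i, (h.nonneg i).lt_of_ne' hi⟩
  have hx := h.smul (inv_pos.2 hsum)
  refine ⟨_, ⟨hx.nonneg, ?_⟩, hx.smul_le⟩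
  simp only [Pi.smul_apply, smul_eq_mul, ← Finset.mul_sum]
  exact inv_mul_cancel₀ hsum.ne'

theorem le_sum_of_smul_le_mulVec_of_mem_stdSimplex (hA : ∀ i j, 0 ≤ A i j) {x : n → ℝ}
    (hx : x ∈ stdSimplex ℝ n) (hle : t • x ≤ A *ᵥ x) : t ≤ ∑ i, ∑ j, A i j :=
  calc
    t = ∑ i, t * x i := by rw [← Finset.mul_sum, hx.2, mul_one]
    _ ≤ ∑ i, ∑ j, A i j * x j := Finset.sum_le_sum fun i _ => hle i
    _ ≤ ∑ i, ∑ j, A i j := by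
      gcongr with i _ j _
      exact mul_le_of_le_one_right (hA i j) (mem_Icc_of_mem_stdSimplex hx j).2

theorem exists_isGreatest_subeigenvalues [Nonempty n] (hA : ∀ i j, 0 ≤ A i j) :
    ∃ ρ, IsGreatest (subeigenvalues A) ρ := by
  classical
  let b := ∑ i, ∑ j, A i j
  let K := {z : ℝ × (n → ℝ) | z ∈ Set.Icc 0 b ×ˢ stdSimplex ℝ n ∧ z.1 • z.2 ≤ A *ᵥ z.2}
  have hK {x : n → ℝ} {t : ℝ} (ht : 0 ≤ t) (hx : x ∈ stdSimplex ℝ n) (hle : t • x ≤ A *ᵥ x) :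
      (t, x) ∈ K :=
    ⟨⟨⟨ht, le_sum_of_smul_le_mulVec_of_mem_stdSimplex hA hx hle⟩, hx⟩, hle⟩
  obtain ⟨v⟩ := ‹Nonempty n›
  have hv : ((0 : ℝ), Pi.single v (1 : ℝ)) ∈ K := by
    refine hK le_rfl (single_mem_stdSimplex ℝ v) ?_
    rw [zero_smul]
    exact fun i => dotProduct_nonneg_of_nonneg (hA i) (single_mem_stdSimplex ℝ v).1
  have hcompact : IsCompact K :=
    (isCompact_Icc.prod (isCompact_stdSimplex ℝ n)).inter_right
      (isClosed_le (f := fun z : ℝ × (n → ℝ) => z.1 • z.2) (by fun_prop) (by fun_prop))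
  obtain ⟨ρ, ⟨⟨_, x⟩, ⟨⟨h0, hx⟩, hle⟩, rfl⟩, hmax⟩ :=
    (hcompact.image continuous_fst).exists_isGreatest ⟨_, Set.mem_image_of_mem Prod.fst hv⟩
  refine ⟨_, ⟨x, hx.1, ?_, hle⟩, ?_⟩
  · rintro rfl
    simpa using hx.2
  · rintro t ⟨y, hy⟩
    rcases le_total t 0 with ht | ht
    · exact ht.trans h0.1
    · obtain ⟨x', hx', hle'⟩ := hy.exists_mem_stdSimplex
      exact hmax ⟨_, hK ht hx' hle', rfl⟩

theorem mulVec_pos {P : Matrix n n ℝ} (hP : ∀ i j, 0 < P i j) (h0 : 0 ≤ y) (hy : y ≠ 0) (i : n) :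
    0 < (P *ᵥ y) i := by
  obtain ⟨j, hj⟩ := Function.ne_iff.1 hy
  exact Finset.sum_pos' (fun k _ => mul_nonneg (hP i k).le (h0 k))
    ⟨j, Finset.mem_univ j, mul_pos (hP i j) ((h0 j).lt_of_ne' hj)⟩

theorem pow_mulVec_of_mulVec_eq_smul [DecidableEq n] (h : A *ᵥ y = t • y) (k : ℕ) :
    (A ^ k) *ᵥ y = t ^ k • y := by
  induction k with
  | zero => simp
  | succ k ih =>
    rw [pow_succ, ← Matrix.mulVec_mulVec, h, Matrix.mulVec_smul, ih, smul_smul, pow_succ']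

theorem exists_commute_pos_of_isIrreducible (hA : A.IsIrreducible) :
    ∃ P, Commute A P ∧ ∀ i j, 0 < P i j := by
  classical
  choose k _ hkpos using (Matrix.isIrreducible_iff_exists_pow_pos hA.nonneg).1 hA
  obtain ⟨N, hN⟩ := (Set.finite_range fun ij : n × n => k ij.1 ij.2).bddAbove
  refine ⟨∑ l ∈ Finset.range (N + 1), A ^ l,
    Commute.sum_right _ _ _ fun l _ => (Commute.refl A).pow_right l, fun i j => ?_⟩
  rw [Matrix.sum_apply]
  exact Finset.sum_pos' (fun l _ => Matrix.pow_apply_nonneg hA.nonneg l i j)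
    ⟨k i j, Finset.mem_range.2 (Nat.lt_succ_of_le (hN ⟨(i, j), rfl⟩)), hkpos i j⟩

theorem exists_gt_mem_subeigenvalues_of_lt (h0 : 0 ≤ y) (hy : y ≠ 0)
    (hlt : ∀ i, t * y i < (A *ᵥ y) i) : ∃ u > t, u ∈ subeigenvalues A := by
  have hev : ∀ᶠ u in nhdsWithin t (Set.Ioi t), ∀ i, u * y i < (A *ᵥ y) i := by
    refine Filter.eventually_all.2 fun i => nhdsWithin_le_nhds ?_
    exact (continuous_id.mul_const (y i)).continuousAt.eventually_lt continuousAt_const (hlt i)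
  obtain ⟨u, hu, hut⟩ := (hev.and self_mem_nhdsWithin).exists
  exact ⟨u, hut, y, h0, hy, fun i => (hu i).le⟩

-- A positive matrix commuting with `A` would spread a defect `A y - ρ y ≠ 0` over all entries.
theorem IsSubeigenvector.mulVec_eq (hA : A.IsIrreducible) (hρ : IsGreatest (subeigenvalues A) ρ)
    (hy : IsSubeigenvector A ρ y) : A *ᵥ y = ρ • y := by
  classical
  by_contra hne
  obtain ⟨P, hcomm, hP⟩ := exists_commute_pos_of_isIrreducible hA
  have hPy := mulVec_pos hP hy.nonneg hy.ne_zero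
  obtain ⟨i, -⟩ := Function.ne_iff.1 hy.ne_zero
  obtain ⟨u, hu, hmem⟩ := exists_gt_mem_subeigenvalues_of_lt (A := A) (t := ρ) (y := P *ᵥ y)
    (fun i => (hPy i).le) (fun h => (hPy i).ne' (congrFun h i)) fun i => by
      have := mulVec_pos hP (sub_nonneg.2 hy.smul_le) (sub_ne_zero.2 hne) i
      rwa [Matrix.mulVec_sub, Matrix.mulVec_smul, Matrix.mulVec_mulVec, ← hcomm.eq,
        ← Matrix.mulVec_mulVec, Pi.sub_apply, sub_pos] at this
  exact (hρ.2 hmem).not_gt hu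

theorem IsSubeigenvector.pos (hA : A.IsIrreducible) (hρ : IsGreatest (subeigenvalues A) ρ)
    (hy : IsSubeigenvector A ρ y) (i : n) : 0 < y i := by
  classical
  obtain ⟨j, hj⟩ := Function.ne_iff.1 hy.ne_zero
  obtain ⟨k, -, hk⟩ := (Matrix.isIrreducible_iff_exists_pow_pos hA.nonneg).1 hA i j
  have hpos : 0 < ((A ^ k) *ᵥ y) i :=
    Finset.sum_pos' (fun l _ => mul_nonneg (Matrix.pow_apply_nonneg hA.nonneg k i l) (hy.nonneg l))
      ⟨j, Finset.mem_univ j, mul_pos hk ((hy.nonneg j).lt_of_ne' hj)⟩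
  refine (hy.nonneg i).lt_of_ne' fun h0 => hpos.ne' ?_
  rw [pow_mulVec_of_mulVec_eq_smul (hy.mulVec_eq hA hρ), Pi.smul_apply, h0]
  exact smul_zero _

theorem isIrreducible_of_transGen {ι : Type*} [Finite ι] {A : Matrix ι ι ℝ}
    (hA : ∀ i j, 0 ≤ A i j)
    (hconn : ∀ i j, Relation.TransGen (fun a b => 0 < A a b) i j) : A.IsIrreducible := by
  classical
  have := Fintype.ofFinite ι
  refine (Matrix.isIrreducible_iff_exists_pow_pos hA).2 fun i j => ?_
  induction hconn i j with
  | single h => exact ⟨1, one_pos, by simpa using h⟩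
  | @tail a b _ hab ih =>
    obtain ⟨k, -, hk⟩ := ih
    refine ⟨k + 1, k.succ_pos, ?_⟩
    rw [pow_succ, Matrix.mul_apply]
    exact Finset.sum_pos' (fun l _ => mul_nonneg (Matrix.pow_apply_nonneg hA k i l) (hA l b))
      ⟨a, Finset.mem_univ a, mul_pos hk hab⟩

theorem IsSubeigenvector.lt_of_mulVec_ne (hA : A.IsIrreducible)
    (hρ : IsGreatest (subeigenvalues A) ρ) (hy : IsSubeigenvector A t y) (hne : A *ᵥ y ≠ t • y) :
    t < ρ := by
  refine lt_of_le_of_ne (hρ.2 ⟨y, hy⟩) ?_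
  rintro rfl
  exact hne (hy.mulVec_eq hA hρ)

section Submatrix

variable {m : Type*} [Fintype m] {f : m → n} {x : m → ℝ}

theorem mulVec_extend_zero (A : Matrix n n ℝ) (hf : f.Injective) (x : m → ℝ) (i : n) :
    (A *ᵥ Function.extend f x 0) i = ∑ j, A i (f j) * x j := by
  rw [Matrix.mulVec_eq_sum, Finset.sum_apply]
  refine (Fintype.sum_of_injective f hf _ _ (fun j hj => ?_) fun j => ?_).symm
  · simp [Function.extend_apply' _ _ _ hj]
  · simp [hf.extend_apply]

theorem IsSubeigenvector.extend_zero (hA : ∀ i j, 0 ≤ A i j) (hf : f.Injective)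
    (hx : IsSubeigenvector (A.submatrix f f) t x) :
    IsSubeigenvector A t (Function.extend f x 0) where
  nonneg i := by
    by_cases hi : ∃ j, f j = i
    · obtain ⟨j, rfl⟩ := hi
      simpa [hf.extend_apply] using hx.nonneg j
    · simp [Function.extend_apply' _ _ _ hi]
  ne_zero h := hx.ne_zero <| funext fun j => by
    simpa [hf.extend_apply] using congrFun h (f j)
  smul_le i := by
    rw [mulVec_extend_zero A hf]
    by_cases hi : ∃ j, f j = i
    · obtain ⟨j, rfl⟩ := hi
      simpa [hf.extend_apply, Matrix.mulVec, dotProduct] using hx.smul_le j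
    · simpa [Function.extend_apply' _ _ _ hi] using
        Finset.sum_nonneg fun j _ => mul_nonneg (hA i (f j)) (hx.nonneg j)

theorem IsSubeigenvector.mem_complementaritySpectrum (hA : ∀ i j, 0 ≤ A i j) (hf : f.Injective)
    (hx : IsSubeigenvector (A.submatrix f f) t x) (heq : A.submatrix f f *ᵥ x = t • x) :
    t ∈ A.complementaritySpectrum := by
  have hext := hx.extend_zero hA hf
  refine ⟨_, hext.ne_zero, hext.nonneg, hext.smul_le, Finset.sum_eq_zero fun i _ => ?_⟩
  by_cases hi : ∃ j, f j = i
  · obtain ⟨j, rfl⟩ := hi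
    have hj : ∑ k, A (f j) (f k) * x k = t * x j := congrFun heq j
    simp [mulVec_extend_zero A hf, hf.extend_apply, hj]
  · simp [Function.extend_apply' _ _ _ hi]

theorem mem_complementaritySpectrum_of_isGreatest (hf : f.Injective)
    (hA : ∀ i j, 0 ≤ A i j) (hirr : (A.submatrix f f).IsIrreducible)
    (hρ : IsGreatest (subeigenvalues (A.submatrix f f)) ρ) : ρ ∈ A.complementaritySpectrum := by
  obtain ⟨x, hx⟩ := hρ.1
  exact hx.mem_complementaritySpectrum hA hf (hx.mulVec_eq hirr hρ)

theorem lt_of_mem_subeigenvalues_submatrix (hA : A.IsIrreducible)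
    (hρ : IsGreatest (subeigenvalues A) ρ) (hf : f.Injective) (hsurj : ¬ f.Surjective)
    (ht : t ∈ subeigenvalues (A.submatrix f f)) : t < ρ := by
  obtain ⟨x, hx⟩ := ht
  have hext := hx.extend_zero hA.nonneg hf
  obtain ⟨i, hi⟩ := not_forall.1 hsurj
  refine lt_of_le_of_ne (hρ.2 ⟨_, hext⟩) ?_
  rintro rfl
  have hpos := hext.pos hA hρ i
  rw [Function.extend_apply' _ _ _ hi] at hpos
  exact lt_irrefl _ hpos

end Submatrix

end PerronFrobenius

section ComplementaritySpectrum

variable {V : Type*} {D : Digraph V}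

/-- The subdigraph of `D` induced by the vertices in `S`. -/
def inducedSubdigraph (D : Digraph V) (S : Set V) : Digraph S where
  Adj x y := D.Adj x y

theorem adjMatrix_nonneg (D : Digraph V) (x y : V) : 0 ≤ D.adjMatrix x y := by
  simp only [Digraph.adjMatrix, Matrix.of_apply]
  split_ifs <;> norm_num

theorem adjMatrix_pos_iff {x y : V} : 0 < D.adjMatrix x y ↔ D.Adj x y := by
  simp [Digraph.adjMatrix, apply_ite]

theorem exists_adj_of_stronglyConnected [Nontrivial V] (hconn : D.StronglyConnected) (x : V) :
    ∃ y, D.Adj x y := by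
  obtain ⟨z, hz⟩ := exists_ne x
  obtain h | ⟨y, hxy, -⟩ := (hconn x z).cases_head
  exacts [absurd h.symm hz, ⟨y, hxy⟩]

theorem isIrreducible_adjMatrix [Finite V] [Nontrivial V] (hconn : D.StronglyConnected) :
    D.adjMatrix.IsIrreducible := by
  refine isIrreducible_of_transGen (adjMatrix_nonneg D) fun x y => ?_
  obtain ⟨z, hxz⟩ := exists_adj_of_stronglyConnected hconn x
  simpa only [adjMatrix_pos_iff] using Relation.TransGen.head' hxz (hconn z y)

variable [Fintype V]

theorem adjMatrix_mulVec_one_apply (D : Digraph V) (x : V) :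
    (D.adjMatrix.mulVec 1) x = {y | D.Adj x y}.ncard := by
  classical
  simp [Digraph.adjMatrix, Matrix.mulVec, dotProduct, Set.ncard_eq_toFinset_card']

theorem isSubeigenvector_one_adjMatrix [Nonempty V] (hout : ∀ x, ∃ y, D.Adj x y) :
    IsSubeigenvector D.adjMatrix 1 1 where
  nonneg := zero_le_one
  ne_zero := one_ne_zero
  smul_le x := by
    rw [adjMatrix_mulVec_one_apply, one_smul, Pi.one_apply, Nat.one_le_cast, Nat.one_le_iff_ne_zero]
    exact Set.ncard_ne_zero_of_mem (hout x).choose_spec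

theorem one_lt_of_isGreatest (hconn : D.StronglyConnected) {w a b : V} (hab : a ≠ b)
    (ha : D.Adj w a) (hb : D.Adj w b) {ρ : ℝ} (hρ : IsGreatest (subeigenvalues D.adjMatrix) ρ) :
    1 < ρ := by
  have : Nontrivial V := ⟨a, b, hab⟩
  refine (isSubeigenvector_one_adjMatrix
    (exists_adj_of_stronglyConnected hconn)).lt_of_mulVec_ne (isIrreducible_adjMatrix hconn) hρ
    fun heq => ?_
  have hw : {y | D.Adj w y}.ncard = 1 := by
    have := congrFun heq w
    rwa [adjMatrix_mulVec_one_apply, one_smul, Pi.one_apply, Nat.cast_eq_one] at this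
  exact hab ((Set.ncard_le_one_iff (Set.toFinite _)).1 hw.le ha hb)

theorem zero_mem_complementaritySpectrum {v : V} (hv : ¬ D.Adj v v) :
    0 ∈ D.complementaritySpectrum := by
  let f : Unit → V := fun _ => v
  have hzero : D.adjMatrix.submatrix f f = 0 := by
    ext i j
    simp [Digraph.adjMatrix, f, hv]
  refine IsSubeigenvector.mem_complementaritySpectrum (f := f) (x := 1) (adjMatrix_nonneg D)
    (Function.injective_of_subsingleton f) ⟨zero_le_one, one_ne_zero, ?_⟩ ?_ <;> simp [hzero]

theorem one_mem_complementaritySpectrum {S : Set V} (hne : S.Nonempty)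
    (hS : ∀ x : S, ∃! y, (inducedSubdigraph D S).Adj x y) : 1 ∈ D.complementaritySpectrum := by
  classical
  have := hne.to_subtype
  refine (isSubeigenvector_one_adjMatrix fun x => (hS x).exists).mem_complementaritySpectrum
    (A := D.adjMatrix) (adjMatrix_nonneg D) Subtype.val_injective (funext fun x => ?_)
  obtain ⟨y, hy⟩ := hS x
  have hout : {y | (inducedSubdigraph D S).Adj x y} = {y} :=
    Set.ext fun z => ⟨fun hz => hy.2 z hz, fun hz => hz ▸ hy.1⟩
  change ((inducedSubdigraph D S).adjMatrix.mulVec 1) x = _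
  rw [adjMatrix_mulVec_one_apply, hout, Set.ncard_singleton]
  simp

theorem four_le_encard_complementaritySpectrum {v : V} (hv : ¬ D.Adj v v)
    (hone : 1 ∈ D.complementaritySpectrum) (hconn : D.StronglyConnected) {S : Set V}
    (hS : (inducedSubdigraph D S).StronglyConnected) {w a b : S} (hab : a ≠ b)
    (ha : D.Adj w a) (hb : D.Adj w b) (huniv : S ≠ Set.univ) :
    4 ≤ D.complementaritySpectrum.encard := by
  classical
  have : Nontrivial S := ⟨a, b, hab⟩
  have : Nontrivial V := Subtype.val_injective.nontrivial (α := S)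
  obtain ⟨ρ, hρ⟩ := exists_isGreatest_subeigenvalues (adjMatrix_nonneg D)
  obtain ⟨σ, hσ⟩ := exists_isGreatest_subeigenvalues (adjMatrix_nonneg (inducedSubdigraph D S))
  have hσ_mem : σ ∈ D.complementaritySpectrum :=
    mem_complementaritySpectrum_of_isGreatest (A := D.adjMatrix) Subtype.val_injective
      (adjMatrix_nonneg D) (isIrreducible_adjMatrix hS) hσ
  have hρ_mem : ρ ∈ D.complementaritySpectrum :=
    mem_complementaritySpectrum_of_isGreatest Function.injective_id
      (adjMatrix_nonneg D) (isIrreducible_adjMatrix hconn) hρ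
  have hσ_gt : 1 < σ := one_lt_of_isGreatest hS hab ha hb hσ
  have hσρ : σ < ρ := by
    refine lt_of_mem_subeigenvalues_submatrix (isIrreducible_adjMatrix hconn) hρ
      Subtype.val_injective (fun hsurj => huniv ?_) hσ.1
    simpa using hsurj.range_eq
  have hsub : ({0, 1, σ, ρ} : Set ℝ) ⊆ D.complementaritySpectrum := by
    rintro _ (rfl | rfl | rfl | rfl)
    exacts [zero_mem_complementaritySpectrum hv, hone, hσ_mem, hρ_mem]
  refine le_trans (le_of_eq ?_) (Set.encard_le_encard hsub)
  rw [Set.encard_insert_of_notMem, Set.encard_insert_of_notMem, Set.encard_pair hσρ.ne]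
  · norm_num
  · rintro (h | rfl) <;> linarith
  · rintro (h | h | rfl) <;> linarith

end ComplementaritySpectrum

section ClosedDiwalks

variable {V : Type*} {D : Digraph V} {S T : Set V} {s : ℕ} {c : ℕ → V}

theorem exists_lt_add_modEq (hs : 0 < s) (i j : ℕ) : ∃ d < s, j + d ≡ i [MOD s] := by
  refine ⟨(i + (s - 1) * j) % s, Nat.mod_lt _ hs, ?_⟩
  calc
    j + (i + (s - 1) * j) % s ≡ j + (i + (s - 1) * j) [MOD s] := (Nat.mod_modEq _ _).add_left j
    _ = i + s * j := by
      obtain ⟨t, rfl⟩ := Nat.exists_eq_add_of_le' hs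
      rw [Nat.add_sub_cancel]
      ring
    _ ≡ i [MOD s] := by simp [Nat.ModEq]

/-- The sequence `c` winds, with period `s`, around a closed directed walk of length `s`. Indexing
by `ℕ` instead of `Fin s` makes rotating the walk a shift of the indices. -/
structure IsClosedDiwalk (D : Digraph V) (s : ℕ) (c : ℕ → V) : Prop where
  pos : 0 < s
  periodic : Function.Periodic c s
  adj : ∀ i, D.Adj (c i) (c (i + 1))

/-- A closed directed walk without repeated vertices, within a period, all of whose chords are
arcs of the walk. -/
structure IsInducedDicycle (D : Digraph V) (s : ℕ) (c : ℕ → V) : Prop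
    extends IsClosedDiwalk D s c where
  modEq_of_eq : ∀ i j, c i = c j → i ≡ j [MOD s]
  modEq_of_adj : ∀ i j, D.Adj (c i) (c j) → j ≡ i + 1 [MOD s]

theorem stronglyConnected_union (hS : (inducedSubdigraph D S).StronglyConnected)
    (hT : (inducedSubdigraph D T).StronglyConnected) (hST : (S ∩ T).Nonempty) :
    (inducedSubdigraph D (S ∪ T)).StronglyConnected := by
  obtain ⟨z, hzS, hzT⟩ := hST
  have hleft (x y : S) := (hS x y).lift (p := (inducedSubdigraph D (S ∪ T)).Adj)
    (Set.inclusion Set.subset_union_left) fun _ _ => id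
  have hright (x y : T) := (hT x y).lift (p := (inducedSubdigraph D (S ∪ T)).Adj)
    (Set.inclusion Set.subset_union_right) fun _ _ => id
  rintro ⟨x, hx | hx⟩ ⟨y, hy | hy⟩
  · exact hleft ⟨x, hx⟩ ⟨y, hy⟩
  · exact (hleft ⟨x, hx⟩ ⟨z, hzS⟩).trans (hright ⟨z, hzT⟩ ⟨y, hy⟩)
  · exact (hright ⟨x, hx⟩ ⟨z, hzT⟩).trans (hleft ⟨z, hzS⟩ ⟨y, hy⟩)
  · exact hright ⟨x, hx⟩ ⟨y, hy⟩

theorem isClosedDiwalk_mod {f : ℕ → V} {d : ℕ} (hadj : ∀ i < d, D.Adj (f i) (f (i + 1)))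
    (hclose : D.Adj (f d) (f 0)) : IsClosedDiwalk D (d + 1) fun k => f (k % (d + 1)) where
  pos := d.succ_pos
  periodic k := by simp
  adj k := by
    rw [← Nat.mod_add_mod]
    obtain hlt | heq := Nat.lt_succ_iff_lt_or_eq.1 (Nat.mod_lt k d.succ_pos)
    · rw [Nat.mod_eq_of_lt (Nat.succ_lt_succ hlt)]
      exact hadj _ hlt
    · rw [heq, Nat.mod_self]
      exact hclose

theorem exists_isClosedDiwalk [Finite V] [Nonempty V] (hout : ∀ x, ∃ y, D.Adj x y) :
    ∃ s c, IsClosedDiwalk D s c := by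
  choose next hnext using hout
  obtain ⟨i, j, hne, hij⟩ :=
    Finite.exists_ne_map_eq_of_infinite fun i : ℕ => next^[i] (Classical.arbitrary V)
  wlog hlt : i < j generalizing i j
  · exact this j i hne.symm hij.symm (by omega)
  refine ⟨j - i, fun k => next^[k + i] (Classical.arbitrary V), by omega, fun k => ?_, fun k => ?_⟩
  · rw [add_assoc, Nat.sub_add_cancel hlt.le, Function.iterate_add_apply _ k j, ← hij,
      ← Function.iterate_add_apply]
  · rw [add_right_comm, Function.iterate_succ_apply']
    exact hnext _

namespace IsClosedDiwalk

theorem apply_eq (h : IsClosedDiwalk D s c) {i j : ℕ} (hij : i ≡ j [MOD s]) : c i = c j := by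
  rw [← h.periodic.map_mod_nat i, hij, h.periodic.map_mod_nat]

theorem exists_add_eq (h : IsClosedDiwalk D s c) (i j : ℕ) : ∃ d < s, c (j + d) = c i := by
  obtain ⟨d, hd, hmod⟩ := exists_lt_add_modEq h.pos i j
  exact ⟨d, hd, h.apply_eq hmod⟩

theorem stronglyConnected_range (h : IsClosedDiwalk D s c) :
    (inducedSubdigraph D (Set.range c)).StronglyConnected := by
  rintro ⟨_, i, rfl⟩ ⟨_, j, rfl⟩
  obtain ⟨d, -, hd⟩ := h.exists_add_eq j i
  have hwalk := (reflTransGen_of_succ_of_le (fun a b => D.Adj (c a) (c b))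
    (fun k _ => h.adj k) (Nat.le_add_right i d)).lift
      (p := (inducedSubdigraph D (Set.range c)).Adj) (Set.rangeFactorization c) fun _ _ => id
  have hend : Set.rangeFactorization c (i + d) = ⟨c j, j, rfl⟩ := Subtype.ext hd
  rwa [Function.onFun, hend] at hwalk

theorem shift (h : IsClosedDiwalk D s c) (r : ℕ) : IsClosedDiwalk D s fun i => c (i + r) where
  pos := h.pos
  periodic i := by simpa only [add_right_comm] using h.periodic (i + r)
  adj i := by
    rw [add_right_comm]
    exact h.adj _

theorem two_le (h : IsClosedDiwalk D s c) (hsimple : D.IsSimple) : 2 ≤ s := by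
  by_contra hlt
  obtain rfl : s = 1 := by have := h.pos; omega
  have hloop := h.adj 0
  rw [h.periodic 0] at hloop
  exact hsimple _ hloop

theorem shortcut (h : IsClosedDiwalk D s c) {i j d : ℕ} (hadj : D.Adj (c i) (c j))
    (hd : j + d ≡ i [MOD s]) : IsClosedDiwalk D (d + 1) fun k => c (j + k % (d + 1)) :=
  isClosedDiwalk_mod (f := fun k => c (j + k)) (fun k _ => h.adj (j + k)) <| by
    simpa only [h.apply_eq hd, add_zero] using hadj

theorem isInducedDicycle (h : IsClosedDiwalk D s c) (hmin : ∀ r b, IsClosedDiwalk D r b → s ≤ r) :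
    IsInducedDicycle D s c := by
  have hchord (i j : ℕ) (hij : D.Adj (c i) (c j)) : j ≡ i + 1 [MOD s] := by
    obtain ⟨d, hds, hd⟩ := exists_lt_add_modEq h.pos i j
    obtain rfl : s = d + 1 := le_antisymm (hmin _ _ (h.shortcut hij hd)) hds
    calc
      j ≡ j + d + 1 [MOD d + 1] := by simp [Nat.ModEq, add_assoc]
      _ ≡ i + 1 [MOD d + 1] := hd.add_right 1
  exact ⟨h, fun i j hij => (hchord j (i + 1) (hij ▸ h.adj i)).add_right_cancel' 1, hchord⟩

end IsClosedDiwalk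

theorem exists_isInducedDicycle [Finite V] [Nonempty V] (hout : ∀ x, ∃ y, D.Adj x y) :
    ∃ s c, IsInducedDicycle D s c := by
  classical
  have hex := exists_isClosedDiwalk hout
  obtain ⟨c, hc⟩ := Nat.find_spec hex
  exact ⟨_, c, hc.isInducedDicycle fun r b hb => Nat.find_min' hex ⟨b, hb⟩⟩

theorem stronglyConnected_image_Iic {f : ℕ → V} {d : ℕ}
    (hadj : ∀ i < d, D.Adj (f i) (f (i + 1))) (hclose : D.Adj (f d) (f 0)) :
    (inducedSubdigraph D (f '' Set.Iic d)).StronglyConnected := by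
  have hrange : f '' Set.Iic d = Set.range fun k => f (k % (d + 1)) := by
    ext x
    constructor
    · rintro ⟨i, hi, rfl⟩
      exact ⟨i, congrArg f (Nat.mod_eq_of_lt (Nat.lt_succ_of_le hi))⟩
    · rintro ⟨i, rfl⟩
      exact ⟨_, Nat.le_of_lt_succ (Nat.mod_lt i d.succ_pos), rfl⟩
  rw [hrange]
  exact (isClosedDiwalk_mod hadj hclose).stronglyConnected_range

namespace IsInducedDicycle

theorem shift (h : IsInducedDicycle D s c) (r : ℕ) : IsInducedDicycle D s fun i => c (i + r) where
  toIsClosedDiwalk := h.toIsClosedDiwalk.shift r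
  modEq_of_eq i j hij := (h.modEq_of_eq _ _ hij).add_right_cancel' r
  modEq_of_adj i j hij := by
    have := h.modEq_of_adj _ _ hij
    rw [add_right_comm] at this
    exact this.add_right_cancel' r

theorem injOn_add (h : IsInducedDicycle D s c) (i : ℕ) :
    Set.InjOn (fun t => c (i + t)) (Set.Iio s) := fun _ ht _ ht' heq =>
  ((h.modEq_of_eq _ _ heq).add_left_cancel' i).eq_of_lt_of_lt ht ht'

theorem apply_ne (h : IsInducedDicycle D s c) {i j : ℕ} (hij : i < j) (hj : j < i + s) :
    c i ≠ c j := by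
  intro heq
  have hdvd := (Nat.modEq_iff_dvd' hij.le).1 (h.modEq_of_eq i j heq)
  exact absurd (Nat.le_of_dvd (by omega) hdvd) (by omega)

theorem existsUnique_adj (h : IsInducedDicycle D s c) (x : Set.range c) :
    ∃! y, (inducedSubdigraph D (Set.range c)).Adj x y := by
  obtain ⟨_, i, rfl⟩ := x
  refine ⟨⟨c (i + 1), i + 1, rfl⟩, h.adj i, ?_⟩
  rintro ⟨_, j, rfl⟩ hij
  exact Subtype.ext (h.apply_eq (h.modEq_of_adj i j hij))

end IsInducedDicycle

end ClosedDiwalks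

section Ears

variable {V : Type*} {D : Digraph V} {C : Set V} {s m : ℕ} {c p : ℕ → V}

/-- Every strongly connected induced subdigraph containing a vertex of outdegree at least two,
within the subdigraph, is all of `D`. -/
def IsBranchCritical (D : Digraph V) : Prop :=
  ∀ S : Set V, (inducedSubdigraph D S).StronglyConnected →
    ∀ w a b : S, a ≠ b → D.Adj w a → D.Adj w b → S = Set.univ

/-- `p 0, …, p (m - 1)` are the inner vertices of a directed walk that leaves `C` and comes back.
Its end vertices in `C` may coincide. -/
structure IsEarWalk (D : Digraph V) (C : Set V) (m : ℕ) (p : ℕ → V) : Prop where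
  pos : 0 < m
  notMem : ∀ k < m, p k ∉ C
  adj : ∀ k, k + 1 < m → D.Adj (p k) (p (k + 1))
  source : ∃ u ∈ C, D.Adj u (p 0)
  target : ∃ v ∈ C, D.Adj (p (m - 1)) v

/-- A walk leaving `C` and coming back with the least number of inner vertices. -/
structure IsShortestEarWalk (D : Digraph V) (C : Set V) (m : ℕ) (p : ℕ → V) : Prop
    extends IsEarWalk D C m p where
  le : ∀ m' p', IsEarWalk D C m' p' → m ≤ m'

/-- An induced directed cycle `c` and a shortest ear `p` of it that together contain all
vertices. -/
structure IsSpanningEar (D : Digraph V) (s : ℕ) (c : ℕ → V) (m : ℕ) (p : ℕ → V) : Prop where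
  two_le : 2 ≤ s
  cycle : IsInducedDicycle D s c
  ear : IsShortestEarWalk D (Set.range c) m p
  cover : ∀ x, (∃ i, c i = x) ∨ ∃ k < m, p k = x

theorem isBranchCritical_of_ncard_eq_three [Fintype V] (hsimple : D.IsSimple)
    (hconn : D.StronglyConnected) (hthree : D.complementaritySpectrum.ncard = 3) :
    IsBranchCritical D := by
  intro S hS w a b hab ha hb
  by_contra huniv
  have : Nontrivial V := ⟨a, b, Subtype.coe_injective.ne hab⟩
  obtain ⟨s, c, hc⟩ := exists_isInducedDicycle (exists_adj_of_stronglyConnected hconn)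
  have hone := one_mem_complementaritySpectrum (Set.range_nonempty c) hc.existsUnique_adj
  have hfour := four_le_encard_complementaritySpectrum (hsimple w) hone hconn hS hab ha hb huniv
  have hfin : D.complementaritySpectrum.Finite := Set.finite_of_ncard_pos (by omega)
  rw [← hfin.cast_ncard_eq, hthree] at hfour
  exact absurd hfour (by norm_num)

theorem exists_adj_of_reflTransGen {x z : V} (h : Relation.ReflTransGen D.Adj x z)
    (hx : x ∈ C) (hz : z ∉ C) : ∃ a ∈ C, ∃ b ∉ C, D.Adj a b := by
  induction h using Relation.ReflTransGen.head_induction_on with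
  | refl => exact absurd hx hz
  | @head a b hab _ ih =>
    by_cases hb : b ∈ C
    · exact ih hb
    · exact ⟨a, hx, b, hb, hab⟩

theorem exists_isEarWalk_of_adj {u y t : V} (hyt : Relation.ReflTransGen D.Adj y t) (ht : t ∈ C)
    (hu : u ∈ C) (hy : y ∉ C) (huy : D.Adj u y) : ∃ m p, IsEarWalk D C m p := by
  suffices ∃ (m : ℕ) (p : ℕ → V), 0 < m ∧ p 0 = y ∧ (∀ k < m, p k ∉ C) ∧
      (∀ k, k + 1 < m → D.Adj (p k) (p (k + 1))) ∧ ∃ v ∈ C, D.Adj (p (m - 1)) v by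
    obtain ⟨m, p, hm, rfl, hp, hadj, hlast⟩ := this
    exact ⟨m, p, hm, hp, hadj, ⟨u, hu, huy⟩, hlast⟩
  clear huy
  induction hyt using Relation.ReflTransGen.head_induction_on with
  | refl => exact absurd ht hy
  | @head a b hab _ ih =>
    by_cases hb : b ∈ C
    · exact ⟨1, fun _ => a, one_pos, rfl, fun _ _ => hy, fun k hk => by omega, b, hb, hab⟩
    · obtain ⟨m, p, hm, rfl, hp, hadj, v, hv, hlast⟩ := ih hb
      obtain ⟨m, rfl⟩ := Nat.exists_eq_add_of_le' hm
      refine ⟨m + 2, fun | 0 => a | k + 1 => p k, by omega, rfl, ?_, ?_, v, hv, hlast⟩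
      · rintro (_ | k) hk
        exacts [hy, hp k (by omega)]
      · rintro (_ | k) hk
        exacts [hab, hadj k (by omega)]

theorem exists_isShortestEarWalk (hconn : D.StronglyConnected) (hne : C.Nonempty)
    (huniv : C ≠ Set.univ) : ∃ m p, IsShortestEarWalk D C m p := by
  classical
  obtain ⟨x, hx⟩ := hne
  obtain ⟨z, hz⟩ := (Set.ne_univ_iff_exists_notMem C).1 huniv
  obtain ⟨u, hu, y, hy, huy⟩ := exists_adj_of_reflTransGen (hconn x z) hx hz
  have hex := exists_isEarWalk_of_adj (hconn y x) hx hu hy huy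
  obtain ⟨p, hp⟩ := Nat.find_spec hex
  exact ⟨_, p, hp, fun m' p' hp' => Nat.find_min' hex ⟨p', hp'⟩⟩

namespace IsEarWalk

theorem take (h : IsEarWalk D C m p) {k : ℕ} (hk : k < m) {v : V} (hv : v ∈ C)
    (hadj : D.Adj (p k) v) : IsEarWalk D C (k + 1) p where
  pos := k.succ_pos
  notMem l hl := h.notMem l (by omega)
  adj l hl := h.adj l (by omega)
  source := h.source
  target := ⟨v, hv, hadj⟩

theorem drop (h : IsEarWalk D C m p) {k : ℕ} (hk : k < m) {u : V} (hu : u ∈ C)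
    (hadj : D.Adj u (p k)) : IsEarWalk D C (m - k) fun t => p (t + k) where
  pos := by omega
  notMem l hl := h.notMem _ (by omega)
  adj l hl := by
    rw [add_right_comm]
    exact h.adj _ (by omega)
  source := ⟨u, hu, by rwa [zero_add]⟩
  target := by
    rw [show m - k - 1 + k = m - 1 by omega]
    exact h.target

theorem shortcut (h : IsEarWalk D C m p) {k e : ℕ} (hk : k + 1 + e < m)
    (hadj : D.Adj (p k) (p (k + 1 + e))) :
    IsEarWalk D C (m - e) fun t => if t ≤ k then p t else p (t + e) where
  pos := by omega
  notMem l hl := by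
    split_ifs
    exacts [h.notMem l (by omega), h.notMem _ (by omega)]
  adj l hl := by
    obtain hlt | rfl | hgt := lt_trichotomy l k
    · simpa [hlt.le, Nat.succ_le_of_lt hlt] using h.adj l (by omega)
    · simpa using hadj
    · simpa [hgt.not_ge, (hgt.trans l.lt_succ_self).not_ge, add_right_comm] using
        h.adj (l + e) (by omega)
  source := by simpa using h.source
  target := by
    simpa [show ¬ m - e - 1 ≤ k by omega, show m - e - 1 + e = m - 1 by omega] using h.target

end IsEarWalk

namespace IsShortestEarWalk

theorem eq_last_of_adj (h : IsShortestEarWalk D C m p) {k : ℕ} (hk : k < m) {v : V} (hv : v ∈ C)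
    (hadj : D.Adj (p k) v) : k = m - 1 := by
  have := h.le _ _ (h.take hk hv hadj)
  omega

theorem eq_zero_of_adj (h : IsShortestEarWalk D C m p) {k : ℕ} (hk : k < m) {u : V} (hu : u ∈ C)
    (hadj : D.Adj u (p k)) : k = 0 := by
  have := h.le _ _ (h.drop hk hu hadj)
  omega

theorem le_succ_of_adj (h : IsShortestEarWalk D C m p) {k l : ℕ} (hl : l < m)
    (hadj : D.Adj (p k) (p l)) : l ≤ k + 1 := by
  by_contra! hlt
  obtain ⟨e, rfl⟩ := Nat.exists_eq_add_of_lt hlt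
  rw [add_assoc (k + 1)] at hl hadj
  have := h.le _ _ (h.shortcut hl hadj)
  omega

theorem injOn (h : IsShortestEarWalk D C m p) : Set.InjOn p (Set.Iio m) := by
  intro k hk l hl heq
  simp only [Set.mem_Iio] at hk hl
  wlog hkl : k ≤ l generalizing k l
  · exact (this heq.symm hl hk (by omega)).symm
  by_cases hlast : l + 1 < m
  · have := h.le_succ_of_adj hlast (heq ▸ h.adj l hlast)
    omega
  · obtain rfl : l = m - 1 := by omega
    obtain ⟨v, hv, hadj⟩ := h.target
    exact h.eq_last_of_adj hk hv (heq ▸ hadj)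

end IsShortestEarWalk

theorem stronglyConnected_ear_union_Icc (hm : 0 < m)
    (hp : ∀ k, k + 1 < m → D.Adj (p k) (p (k + 1))) (hc : ∀ i, D.Adj (c i) (c (i + 1))) {j q : ℕ}
    (hj : D.Adj (p (m - 1)) (c j)) (hq : D.Adj (c (j + q)) (p 0)) :
    (inducedSubdigraph D (p '' Set.Iio m ∪ c '' Set.Icc j (j + q))).StronglyConnected := by
  let f : ℕ → V := fun t => if t < m then p t else c (j + (t - m))
  have hp_eq : ∀ t < m, f t = p t := fun t ht => if_pos ht
  have hc_eq (i : ℕ) : f (m + i) = c (j + i) := by simp [f]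
  have himage : p '' Set.Iio m ∪ c '' Set.Icc j (j + q) = f '' Set.Iic (m + q) := by
    ext x
    constructor
    · rintro (⟨k, hk, rfl⟩ | ⟨i, ⟨hji, hi⟩, rfl⟩)
      · exact ⟨k, (Set.mem_Iio.1 hk).le.trans (Nat.le_add_right m q), hp_eq k hk⟩
      · obtain ⟨i, rfl⟩ := Nat.exists_eq_add_of_le hji
        exact ⟨m + i, by simpa using hi, hc_eq i⟩
    · rintro ⟨t, ht, rfl⟩
      obtain hlt | ⟨i, rfl⟩ := (lt_or_ge t m).imp_right Nat.exists_eq_add_of_le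
      · exact Or.inl ⟨t, hlt, (hp_eq t hlt).symm⟩
      · exact Or.inr ⟨j + i, by simpa using ht, (hc_eq i).symm⟩
  rw [himage]
  refine stronglyConnected_image_Iic (fun t ht => ?_) (by rwa [hc_eq, hp_eq 0 hm])
  obtain hlt | ⟨i, rfl⟩ := (lt_or_ge t m).imp_right Nat.exists_eq_add_of_le
  · rw [hp_eq t hlt]
    obtain hlt' | rfl := Nat.lt_or_eq_of_le (Nat.succ_le_of_lt hlt)
    · rw [hp_eq _ hlt']
      exact hp t hlt'
    · rwa [hc_eq 0]
  · rw [hc_eq, add_assoc, hc_eq]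
    exact hc _

theorem exists_isSpanningEar (hsimple : D.IsSimple) (hconn : D.StronglyConnected)
    (hcrit : IsBranchCritical D) (hc : IsInducedDicycle D s c) (huniv : Set.range c ≠ Set.univ) :
    ∃ m p, IsSpanningEar D s c m p := by
  obtain ⟨m, p, hp⟩ := exists_isShortestEarWalk hconn (Set.range_nonempty c) huniv
  obtain ⟨_, ⟨u, rfl⟩, hu⟩ := hp.source
  obtain ⟨_, ⟨v, rfl⟩, hv⟩ := hp.target
  obtain ⟨q, -, hq⟩ := hc.exists_add_eq u v
  have hear := stronglyConnected_ear_union_Icc hp.pos hp.adj hc.adj hv (q := q) (hq ▸ hu)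
  have hunion := stronglyConnected_union hc.stronglyConnected_range hear
    ⟨c v, ⟨v, rfl⟩, Or.inr ⟨v, by simp, rfl⟩⟩
  have hspan := hcrit _ hunion ⟨c u, Or.inl ⟨u, rfl⟩⟩ ⟨c (u + 1), Or.inl ⟨u + 1, rfl⟩⟩
    ⟨p 0, Or.inr (Or.inl ⟨0, hp.pos, rfl⟩)⟩
    (fun h => hp.notMem 0 hp.pos ⟨u + 1, congrArg Subtype.val h⟩) (hc.adj u) hu
  refine ⟨m, p, hc.two_le hsimple, hc, hp, fun x => ?_⟩
  obtain hx | ⟨k, hk, rfl⟩ | ⟨i, -, rfl⟩ := hspan.symm ▸ Set.mem_univ x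
  exacts [Or.inl hx, Or.inr ⟨k, hk, rfl⟩, Or.inl ⟨i, rfl⟩]

namespace IsSpanningEar

theorem apply_ne (h : IsSpanningEar D s c m p) {k : ℕ} (hk : k < m) (i : ℕ) : p k ≠ c i :=
  fun heq => h.ear.notMem k hk ⟨i, heq.symm⟩

theorem shift (h : IsSpanningEar D s c m p) (r : ℕ) :
    IsSpanningEar D s (fun i => c (i + r)) m p := by
  have hsurj (i : ℕ) : ∃ j, c (j + r) = c i := by
    obtain ⟨d, -, hd⟩ := h.cycle.exists_add_eq i r
    exact ⟨d, by rwa [add_comm]⟩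
  have hrange : Set.range (fun i => c (i + r)) = Set.range c :=
    Set.Subset.antisymm (Set.range_comp_subset_range (· + r) c) (Set.range_subset_iff.2 hsurj)
  refine ⟨h.two_le, h.cycle.shift r, hrange.symm ▸ h.ear, fun x => ?_⟩
  obtain ⟨i, rfl⟩ | hx := h.cover x
  exacts [Or.inl (hsurj i), Or.inr hx]

theorem exists_source (h : IsSpanningEar D s c m p) (j : ℕ) :
    ∃ q < s, D.Adj (c (j + q)) (p 0) := by
  obtain ⟨_, ⟨i, rfl⟩, hi⟩ := h.ear.source
  obtain ⟨q, hq, heq⟩ := h.cycle.exists_add_eq i j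
  exact ⟨q, hq, heq ▸ hi⟩

theorem exists_target (h : IsSpanningEar D s c m p) : ∃ j, D.Adj (p (m - 1)) (c j) := by
  obtain ⟨_, ⟨j, rfl⟩, hj⟩ := h.ear.target
  exact ⟨j, hj⟩

theorem eq_sub_one_of_branching (h : IsSpanningEar D s c m p) (hcrit : IsBranchCritical D)
    {j q : ℕ} (hj : D.Adj (p (m - 1)) (c j)) (hq : D.Adj (c (j + q)) (p 0)) (hqs : q < s)
    {w a b : ↥(p '' Set.Iio m ∪ c '' Set.Icc j (j + q))} (hab : a ≠ b) (ha : D.Adj w a)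
    (hb : D.Adj w b) : q = s - 1 := by
  by_contra hne
  -- The closed walk along the ear and then `c j, …, c (j + q)` misses `c (j + q + 1)`.
  have huniv := hcrit _ (stronglyConnected_ear_union_Icc h.ear.pos h.ear.adj h.cycle.adj hj hq)
    w a b hab ha hb
  obtain ⟨k, hk, heq⟩ | ⟨i, ⟨hji, hij⟩, heq⟩ := huniv.symm ▸ Set.mem_univ (c (j + q + 1))
  · exact h.apply_ne hk _ heq
  · exact h.cycle.apply_ne (by omega) (by omega) heq

theorem source_eq_sub_one (h : IsSpanningEar D s c m p) (hcrit : IsBranchCritical D) {j q q' : ℕ}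
    (hj : D.Adj (p (m - 1)) (c j)) (hq : D.Adj (c (j + q)) (p 0)) (hq' : D.Adj (c (j + q')) (p 0))
    (hlt : q < q') (hs : q' < s) : q' = s - 1 :=
  h.eq_sub_one_of_branching hcrit hj hq' hs
    (w := ⟨c (j + q), Or.inr ⟨j + q, by simp [hlt.le], rfl⟩⟩)
    (a := ⟨c (j + q + 1), Or.inr ⟨j + q + 1, by simpa [add_assoc] using hlt, rfl⟩⟩)
    (b := ⟨p 0, Or.inl ⟨0, h.ear.pos, rfl⟩⟩)
    (Subtype.coe_ne_coe.1 (h.apply_ne h.ear.pos _).symm) (h.cycle.adj _) hq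

theorem target_eq_zero (h : IsSpanningEar D s c m p) (hcrit : IsBranchCritical D) {i a a' : ℕ}
    (hi : D.Adj (c i) (p 0)) (ha : D.Adj (p (m - 1)) (c (i + 1 + a)))
    (ha' : D.Adj (p (m - 1)) (c (i + 1 + a'))) (hlt : a < a') (hs : a' < s) : a = 0 := by
  have hsource : D.Adj (c (i + 1 + a + (s - 1 - a))) (p 0) := by
    rwa [show i + 1 + a + (s - 1 - a) = i + s by omega, h.cycle.periodic]
  have := h.eq_sub_one_of_branching hcrit ha hsource (by omega)
    (w := ⟨p (m - 1), Or.inl ⟨m - 1, Nat.sub_lt h.ear.pos one_pos, rfl⟩⟩)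
    (a := ⟨c (i + 1 + a), Or.inr ⟨_, by simp, rfl⟩⟩)
    (b := ⟨c (i + 1 + a'), Or.inr ⟨_, Set.mem_Icc.2 (by omega), rfl⟩⟩)
    (Subtype.coe_ne_coe.1 (h.cycle.apply_ne (by omega) (by omega))) ha ha'
  omega

theorem eq_sub_one_of_back (h : IsSpanningEar D s c m p) (hcrit : IsBranchCritical D)
    {j q k l : ℕ} (hj : D.Adj (p (m - 1)) (c j)) (hq : D.Adj (c (j + q)) (p 0)) (hs : q < s)
    (hk : k < m) (hl : l ≤ k) (hkl : D.Adj (p k) (p l)) : q = s - 1 := by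
  have hear {t : ℕ} (ht : t < m) : p t ∈ p '' Set.Iio m ∪ c '' Set.Icc j (j + q) :=
    Or.inl ⟨t, ht, rfl⟩
  obtain hkm | rfl : k + 1 < m ∨ k = m - 1 := by omega
  · refine h.eq_sub_one_of_branching hcrit hj hq hs (w := ⟨p k, hear hk⟩)
      (a := ⟨p l, hear (by omega)⟩) (b := ⟨p (k + 1), hear hkm⟩) (fun heq => ?_) hkl
      (h.ear.adj k hkm)
    have := h.ear.injOn (show l < m by omega) hkm (congrArg Subtype.val heq)
    omega
  · exact h.eq_sub_one_of_branching hcrit hj hq hs (w := ⟨p (m - 1), hear hk⟩)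
      (a := ⟨p l, hear (by omega)⟩) (b := ⟨c j, Or.inr ⟨j, by simp, rfl⟩⟩)
      (Subtype.coe_ne_coe.1 (h.apply_ne (by omega) j)) hkl hj

end IsSpanningEar

theorem stronglyConnected_image_Icc {f : ℕ → V} {l k : ℕ} (hlk : l ≤ k)
    (hadj : ∀ i, l ≤ i → i < k → D.Adj (f i) (f (i + 1))) (hclose : D.Adj (f k) (f l)) :
    (inducedSubdigraph D (f '' Set.Icc l k)).StronglyConnected := by
  obtain ⟨d, rfl⟩ := Nat.exists_eq_add_of_le hlk
  have himage : f '' Set.Icc l (l + d) = (fun t => f (l + t)) '' Set.Iic d := by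
    ext x
    constructor
    · rintro ⟨i, ⟨hli, hi⟩, rfl⟩
      obtain ⟨t, rfl⟩ := Nat.exists_eq_add_of_le hli
      exact ⟨t, by simpa using hi, rfl⟩
    · rintro ⟨t, ht, rfl⟩
      exact ⟨l + t, by simpa using ht, rfl⟩
  rw [himage]
  exact stronglyConnected_image_Iic (fun i hi => hadj _ (by omega) (by omega)) hclose

namespace IsSpanningEar

theorem eq_of_back_overlap (h : IsSpanningEar D s c m p) (hcrit : IsBranchCritical D)
    {k l k' l' : ℕ} (hl : l ≤ k) (hkl : D.Adj (p k) (p l)) (hk' : k' < m) (hl' : l' ≤ k')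
    (hkl' : D.Adj (p k') (p l')) (hle : l' ≤ k) (hkk' : k ≤ k') : k = k' ∧ l = l' := by
  have hunion := stronglyConnected_union
    (stronglyConnected_image_Icc hl (fun i _ hi => h.ear.adj i (by omega)) hkl)
    (stronglyConnected_image_Icc hl' (fun i _ hi => h.ear.adj i (by omega)) hkl')
    ⟨p k, ⟨k, ⟨hl, le_rfl⟩, rfl⟩, ⟨k, ⟨hle, hkk'⟩, rfl⟩⟩
  have huniv : p '' Set.Icc l k ∪ p '' Set.Icc l' k' ≠ Set.univ := by
    refine (Set.ne_univ_iff_exists_notMem _).2 ⟨c 0, ?_⟩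
    rintro (⟨t, ht, heq⟩ | ⟨t, ht, heq⟩)
    exacts [h.apply_ne ((ht.2.trans hkk').trans_lt hk') 0 heq, h.apply_ne (ht.2.trans_lt hk') 0 heq]
  by_contra hne
  obtain hlt | rfl := hkk'.lt_or_eq
  · refine huniv (hcrit _ hunion ⟨p k, Or.inl ⟨k, ⟨hl, le_rfl⟩, rfl⟩⟩
      ⟨p l, Or.inl ⟨l, ⟨le_rfl, hl⟩, rfl⟩⟩ ⟨p (k + 1), Or.inr ⟨k + 1, ⟨by omega, hlt⟩, rfl⟩⟩
      (fun heq => ?_) hkl (h.ear.adj k (by omega)))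
    have := h.ear.injOn (show l < m by omega) (show k + 1 < m by omega) (congrArg Subtype.val heq)
    omega
  · refine huniv (hcrit _ hunion ⟨p k, Or.inl ⟨k, ⟨hl, le_rfl⟩, rfl⟩⟩
      ⟨p l, Or.inl ⟨l, ⟨le_rfl, hl⟩, rfl⟩⟩ ⟨p l', Or.inr ⟨l', ⟨le_rfl, hl'⟩, rfl⟩⟩
      (fun heq => hne ⟨rfl, ?_⟩) hkl hkl')
    exact h.ear.injOn (hl.trans_lt hk') (hl'.trans_lt hk') (congrArg Subtype.val heq)

end IsSpanningEar

end Ears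

section InnerPaths

variable {V : Type*} {D : Digraph V} {u v w : V} {a b d m s : ℕ} {c f p q r : ℕ → V}

/-- The sequence `u, p 0, …, p (m - 1), v`, constant after its index `m + 1`. -/
def pathWithEnds (u : V) (m : ℕ) (p : ℕ → V) (v : V) : ℕ → V
  | 0 => u
  | k + 1 => if k < m then p k else v

/-- `p 0, …, p (m - 1)` are the inner vertices of a directed path of `D` from `u` to `v`, or of a
directed cycle through `u` if `u = v`. -/
structure IsInnerPath (D : Digraph V) (u : V) (m : ℕ) (p : ℕ → V) (v : V) : Prop where
  injOn : Set.InjOn p (Set.Iio m)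
  ne_source : ∀ k < m, p k ≠ u
  ne_target : ∀ k < m, p k ≠ v
  adj : ∀ i ≤ m, D.Adj (pathWithEnds u m p v i) (pathWithEnds u m p v (i + 1))

theorem pathWithEnds_last : pathWithEnds u m p v (m + 1) = v :=
  if_neg (lt_irrefl m)

theorem pathWithEnds_succ {k : ℕ} (hk : k < m) : pathWithEnds u m p v (k + 1) = p k :=
  if_pos hk

theorem pathWithEnds_segment {i k x : ℕ} (hx : x ≤ k + 1) :
    pathWithEnds (f i) k (fun t => f (i + 1 + t)) (f (i + k + 1)) x = f (i + x) := by
  cases x with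
  | zero => rfl
  | succ x =>
    obtain hlt | rfl := (Nat.le_of_succ_le_succ hx).lt_or_eq
    · rw [pathWithEnds_succ hlt, add_right_comm, add_assoc]
    · rw [pathWithEnds_last, add_assoc]

theorem isInnerPath_of_adj (hm : 0 < m) (hinj : Set.InjOn p (Set.Iio m)) (hu : ∀ k < m, p k ≠ u)
    (hv : ∀ k < m, p k ≠ v) (hfirst : D.Adj u (p 0))
    (hadj : ∀ k, k + 1 < m → D.Adj (p k) (p (k + 1))) (hlast : D.Adj (p (m - 1)) v) :
    IsInnerPath D u m p v where
  injOn := hinj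
  ne_source := hu
  ne_target := hv
  adj i hi := by
    cases i with
    | zero => rwa [pathWithEnds_succ hm]
    | succ k =>
      rw [pathWithEnds_succ hi]
      obtain hlt | rfl := (Nat.succ_le_of_lt hi).lt_or_eq
      · rw [pathWithEnds_succ hlt]
        exact hadj k hlt
      · rwa [pathWithEnds_last]

theorem IsInducedDicycle.isInnerPath (h : IsInducedDicycle D s c) (i : ℕ) {k : ℕ} (hk : k < s) :
    IsInnerPath D (c i) k (fun t => c (i + 1 + t)) (c (i + k + 1)) where
  injOn := (h.injOn_add (i + 1)).mono (Set.Iio_subset_Iio hk.le)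
  ne_source t ht := (h.apply_ne (by omega) (by omega)).symm
  ne_target t ht := h.apply_ne (by omega) (by omega)
  adj x hx := by
    rw [pathWithEnds_segment (by omega), pathWithEnds_segment (by omega)]
    exact h.adj _

theorem IsSpanningEar.isInnerPath (h : IsSpanningEar D s c m p) {i j : ℕ}
    (hi : D.Adj (c i) (p 0)) (hj : D.Adj (p (m - 1)) (c j)) : IsInnerPath D (c i) m p (c j) :=
  isInnerPath_of_adj h.ear.pos h.ear.injOn (fun _ hk => h.apply_ne hk i)
    (fun _ hk => h.apply_ne hk j) hi h.ear.adj hj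

theorem isPathArc_iff {x y : V} : Digraph.IsPathArc (fun i : Fin (m + 2) => f i) x y ↔
    ∃ i ≤ m, f i = x ∧ f (i + 1) = y := by
  constructor
  · rintro ⟨i, j, hij, rfl, rfl⟩
    exact ⟨i, by omega, rfl, congrArg f hij.symm⟩
  · rintro ⟨i, hi, rfl, rfl⟩
    exact ⟨⟨i, by omega⟩, ⟨i + 1, by omega⟩, rfl, rfl, rfl⟩

namespace IsInnerPath

theorem injOn_pathWithEnds_Iic (h : IsInnerPath D u m p v) :
    Set.InjOn (pathWithEnds u m p v) (Set.Iic m) := by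
  rintro (_ | k) hk (_ | l) hl heq
  · rfl
  · rw [pathWithEnds_succ hl] at heq
    exact absurd heq.symm (h.ne_source l hl)
  · rw [pathWithEnds_succ hk] at heq
    exact absurd heq (h.ne_source k hk)
  · rw [pathWithEnds_succ hk, pathWithEnds_succ hl] at heq
    exact congrArg _ (h.injOn hk hl heq)

theorem injective_pathWithEnds (h : IsInnerPath D u m p v) (huv : u ≠ v) :
    Function.Injective fun i : Fin (m + 2) => pathWithEnds u m p v i := by
  have hlast : ∀ i ≤ m, pathWithEnds u m p v i ≠ v := by
    rintro (_ | k) hk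
    · exact huv
    · rw [pathWithEnds_succ hk]
      exact h.ne_target k hk
  intro i j heq
  dsimp only at heq
  have hi := Nat.lt_succ_iff_lt_or_eq.1 i.2
  have hj := Nat.lt_succ_iff_lt_or_eq.1 j.2
  apply Fin.ext
  obtain hi | hi := hi <;> obtain hj | hj := hj
  · exact h.injOn_pathWithEnds_Iic (Nat.le_of_lt_succ hi) (Nat.le_of_lt_succ hj) heq
  · rw [hj, pathWithEnds_last] at heq
    exact absurd heq (hlast _ (Nat.le_of_lt_succ hi))
  · rw [hi, pathWithEnds_last] at heq
    exact absurd heq.symm (hlast _ (Nat.le_of_lt_succ hj))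
  · rw [hi, hj]

theorem adj_of_isCycleArc (h : IsInnerPath D u m p u) {x y : V}
    (hxy : Digraph.IsCycleArc (fun i : Fin (m + 1) => pathWithEnds u m p u i) x y) :
    D.Adj x y := by
  obtain ⟨i, j, hij, rfl, rfl⟩ := hxy
  have hadj := h.adj i (Nat.le_of_lt_succ i.2)
  dsimp only
  obtain hlt | heq := Nat.lt_succ_iff_lt_or_eq.1 i.2
  · rwa [hij, Nat.mod_eq_of_lt (Nat.succ_lt_succ hlt)]
  · rw [heq, pathWithEnds_last] at hadj
    rw [hij, heq, Nat.mod_self]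
    exact hadj

theorem adj_of_isPathArc (h : IsInnerPath D u m p v) {x y : V}
    (hxy : Digraph.IsPathArc (fun i : Fin (m + 2) => pathWithEnds u m p v i) x y) : D.Adj x y := by
  obtain ⟨i, hi, rfl, rfl⟩ := isPathArc_iff.1 hxy
  exact h.adj i hi

end IsInnerPath

theorem hasInfinitySubdigraph_of_isInnerPath (ha : 0 < a) (hb : 0 < b) (hp : IsInnerPath D u a p u)
    (hq : IsInnerPath D u b q u) (hpq : ∀ i < a, ∀ j < b, p i ≠ q j) :
    D.HasInfinitySubdigraph := by
  let P : Fin (a + 1) → V := fun i => pathWithEnds u a p u i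
  let Q : Fin (b + 1) → V := fun i => pathWithEnds u b q u i
  refine ⟨Set.range P ∪ Set.range Q,
    ⟨fun x y => Digraph.IsCycleArc P x y ∨ Digraph.IsCycleArc Q x y⟩, ?_, a + 1, b + 1,
    by omega, by omega, fun i => ⟨P i, Or.inl ⟨i, rfl⟩⟩, fun i => ⟨Q i, Or.inr ⟨i, rfl⟩⟩,
    ?_, ?_, ?_, ?_, ?_⟩
  · rintro x y (hxy | hxy)
    exacts [hp.adj_of_isCycleArc hxy, hq.adj_of_isCycleArc hxy]
  · exact fun i j hij => Fin.ext <| hp.injOn_pathWithEnds_Iic (Nat.le_of_lt_succ i.2)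
      (Nat.le_of_lt_succ j.2) (congrArg Subtype.val hij)
  · exact fun i j hij => Fin.ext <| hq.injOn_pathWithEnds_Iic (Nat.le_of_lt_succ i.2)
      (Nat.le_of_lt_succ j.2) (congrArg Subtype.val hij)
  · rintro ⟨_ | i, hi⟩ ⟨_ | j, hj⟩
    · simp [P, Q, pathWithEnds]
    · simpa [P, Q, pathWithEnds, Nat.lt_of_succ_lt_succ hj] using
        (hq.ne_source j (Nat.lt_of_succ_lt_succ hj)).symm
    · simpa [P, Q, pathWithEnds, Nat.lt_of_succ_lt_succ hi] using
        hp.ne_source i (Nat.lt_of_succ_lt_succ hi)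
    · simpa [P, Q, pathWithEnds, Nat.lt_of_succ_lt_succ hi, Nat.lt_of_succ_lt_succ hj] using
        hpq i (Nat.lt_of_succ_lt_succ hi) j (Nat.lt_of_succ_lt_succ hj)
  · rintro ⟨_, ⟨i, rfl⟩ | ⟨i, rfl⟩⟩
    exacts [Or.inl ⟨i, rfl⟩, Or.inr ⟨i, rfl⟩]
  · simp only [Digraph.IsCycleArc, Subtype.ext_iff, implies_true]

theorem pathWithEnds_eq_parallel_iff (hwv : w ≠ v) (hp : IsInnerPath D w a p v)
    (hq : IsInnerPath D w b q v) (hpq : ∀ i < a, ∀ j < b, p i ≠ q j) (i : Fin (a + 2))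
    (j : Fin (b + 2)) : pathWithEnds w a p v i = pathWithEnds w b q v j ↔
      (i = 0 ∧ j = 0) ∨ (i = Fin.last _ ∧ j = Fin.last _) := by
  obtain ⟨_ | i, hi⟩ := i <;> obtain ⟨_ | j, hj⟩ := j <;>
    simp only [pathWithEnds, Fin.ext_iff, Fin.val_zero, Fin.val_last]
  all_goals have := hp.ne_source; have := hq.ne_source; have := hp.ne_target; have := hq.ne_target
  all_goals grind

theorem pathWithEnds_eq_antiparallel_iff (hwv : w ≠ v) (hp : IsInnerPath D w a p v)
    (hr : IsInnerPath D v d r w) (hpr : ∀ i < a, ∀ j < d, p i ≠ r j) (i : Fin (a + 2))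
    (j : Fin (d + 2)) : pathWithEnds w a p v i = pathWithEnds v d r w j ↔
      (i = 0 ∧ j = Fin.last _) ∨ (i = Fin.last _ ∧ j = 0) := by
  obtain ⟨_ | i, hi⟩ := i <;> obtain ⟨_ | j, hj⟩ := j <;>
    simp only [pathWithEnds, Fin.ext_iff, Fin.val_zero, Fin.val_last]
  all_goals have := hp.ne_source; have := hr.ne_source; have := hp.ne_target; have := hr.ne_target
  all_goals grind

theorem isThetaDigraph_of_isInnerPath (hwv : w ≠ v) (hab : 0 < a ∨ 0 < b)
    (hp : IsInnerPath D w a p v) (hq : IsInnerPath D w b q v) (hr : IsInnerPath D v d r w)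
    (hpq : ∀ i < a, ∀ j < b, p i ≠ q j) (hpr : ∀ i < a, ∀ j < d, p i ≠ r j)
    (hqr : ∀ i < b, ∀ j < d, q i ≠ r j) (hout : ∀ x, ∃ y, D.Adj x y)
    (harc : ∀ x y, D.Adj x y →
      Digraph.IsPathArc (fun i : Fin (a + 2) => pathWithEnds w a p v i) x y ∨
      Digraph.IsPathArc (fun i : Fin (b + 2) => pathWithEnds w b q v i) x y ∨
      Digraph.IsPathArc (fun i : Fin (d + 2) => pathWithEnds v d r w i) x y) :
    D.IsThetaDigraph := by
  wlog hle : a ≤ b generalizing a b p q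
  · exact this hab.symm hq hp (fun i hi j hj => (hpq j hj i hi).symm) hqr hpr
      (fun x y hxy => or_left_comm.1 (harc x y hxy)) (by omega)
  refine ⟨a, b, d, _, _, _, hle, by omega, hp.injective_pathWithEnds hwv,
    hq.injective_pathWithEnds hwv, hr.injective_pathWithEnds hwv.symm,
    pathWithEnds_eq_parallel_iff hwv hp hq hpq, pathWithEnds_eq_antiparallel_iff hwv hp hr hpr,
    pathWithEnds_eq_antiparallel_iff hwv hq hr hqr, fun x => ?_, fun x y => ⟨harc x y, ?_⟩⟩
  · obtain ⟨y, hxy⟩ := hout x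
    obtain ⟨i, -, -, hi, -⟩ | ⟨i, -, -, hi, -⟩ | ⟨i, -, -, hi, -⟩ := harc x y hxy
    exacts [Or.inl (Or.inl ⟨i, hi⟩), Or.inl (Or.inr ⟨i, hi⟩), Or.inr ⟨i, hi⟩]
  · rintro (hxy | hxy | hxy)
    exacts [hp.adj_of_isPathArc hxy, hq.adj_of_isPathArc hxy, hr.adj_of_isPathArc hxy]

end InnerPaths

section Classification

variable {V : Type*} {D : Digraph V} {s m : ℕ} {c p : ℕ → V}

theorem exists_adj_adj_of_hasThetaSubdigraph (h : D.HasThetaSubdigraph) :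
    ∃ w a b, a ≠ b ∧ D.Adj w a ∧ D.Adj w b := by
  obtain ⟨S, H, hsub, a, b, d, p, q, r, -, hb, -, -, -, hpq, -, -, -, hadj⟩ := h
  have hstart : p 0 = q 0 := (hpq 0 0).2 (Or.inl ⟨rfl, rfl⟩)
  refine ⟨p 0, p 1, q 1, fun heq => ?_, hsub _ _ ((hadj _ _).2 (Or.inl ⟨0, 1, by simp, rfl, rfl⟩)),
    hstart ▸ hsub _ _ ((hadj _ _).2 (Or.inr (Or.inl ⟨0, 1, by simp, rfl, rfl⟩)))⟩
  obtain ⟨hzero, -⟩ | ⟨-, hlast⟩ := (hpq 1 1).1 (Subtype.ext heq)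
  · simp at hzero
  · have := congrArg Fin.val hlast
    simp only [Fin.val_one, Fin.val_last] at this
    omega

theorem range_ne_univ_of_adj_adj (hc : IsInducedDicycle D s c) {w a b : V} (hab : a ≠ b)
    (ha : D.Adj w a) (hb : D.Adj w b) : Set.range c ≠ Set.univ := by
  intro huniv
  obtain ⟨i, rfl⟩ := huniv.symm ▸ Set.mem_univ w
  obtain ⟨j, rfl⟩ := huniv.symm ▸ Set.mem_univ a
  obtain ⟨k, rfl⟩ := huniv.symm ▸ Set.mem_univ b
  exact hab (hc.apply_eq ((hc.modEq_of_adj i j ha).trans (hc.modEq_of_adj i k hb).symm))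

namespace IsSpanningEar

theorem adj_cycle_iff (h : IsSpanningEar D s c m p) {i j : ℕ} (hi : i < s) (hj : j < s) :
    D.Adj (c i) (c j) ↔ j = i + 1 ∨ (i + 1 = s ∧ j = 0) := by
  constructor
  · intro hij
    have hmod := h.cycle.modEq_of_adj i j hij
    obtain hlt | rfl := (Nat.succ_le_of_lt hi).lt_or_eq
    · exact Or.inl (hmod.eq_of_lt_of_lt hj hlt)
    · exact Or.inr ⟨rfl, (hmod.trans (by simp [Nat.ModEq])).eq_of_lt_of_lt hj (by omega)⟩
  · rintro (rfl | ⟨rfl, rfl⟩)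
    · exact h.cycle.adj i
    · simpa only [h.cycle.periodic.eq] using h.cycle.adj i

theorem adj_ear_iff (h : IsSpanningEar D s c m p) {k l : ℕ} (hl : l < m) :
    D.Adj (p k) (p l) ↔ l = k + 1 ∨ (l ≤ k ∧ D.Adj (p k) (p l)) := by
  constructor
  · intro hkl
    have := h.ear.le_succ_of_adj hl hkl
    exact (Nat.le_or_eq_of_le_succ this).symm.imp_right fun hle => ⟨hle, hkl⟩
  · rintro (rfl | ⟨-, hkl⟩)
    exacts [h.ear.adj k hl, hkl]

theorem adj_source_iff (h : IsSpanningEar D s c m p) {i k : ℕ} (hk : k < m) :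
    D.Adj (c i) (p k) ↔ k = 0 ∧ D.Adj (c i) (p 0) := by
  constructor
  · intro hik
    obtain rfl := h.ear.eq_zero_of_adj hk ⟨i, rfl⟩ hik
    exact ⟨rfl, hik⟩
  · rintro ⟨rfl, hi⟩
    exact hi

theorem adj_target_iff (h : IsSpanningEar D s c m p) {j k : ℕ} (hk : k < m) :
    D.Adj (p k) (c j) ↔ k = m - 1 ∧ D.Adj (p (m - 1)) (c j) := by
  constructor
  · intro hkj
    obtain rfl := h.ear.eq_last_of_adj hk ⟨j, rfl⟩ hkj
    exact ⟨rfl, hkj⟩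
  · rintro ⟨rfl, hj⟩
    exact hj

theorem cover_lt (h : IsSpanningEar D s c m p) (x : V) :
    (∃ i < s, c i = x) ∨ ∃ k < m, p k = x := by
  obtain ⟨i, rfl⟩ | hx := h.cover x
  · exact Or.inl ⟨i % s, Nat.mod_lt _ h.cycle.pos, h.cycle.periodic.map_mod_nat i⟩
  · exact Or.inr hx

theorem exists_adj (h : IsSpanningEar D s c m p) (x : V) : ∃ y, D.Adj x y := by
  obtain ⟨i, rfl⟩ | ⟨k, hk, rfl⟩ := h.cover x
  · exact ⟨_, h.cycle.adj i⟩
  · obtain hlt | rfl : k + 1 < m ∨ k = m - 1 := by omega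
    · exact ⟨_, h.ear.adj k hlt⟩
    · obtain ⟨j, hj⟩ := h.exists_target
      exact ⟨_, hj⟩

theorem adj_cases (h : IsSpanningEar D s c m p) {x y : V} (hxy : D.Adj x y) :
    (∃ i < s, c i = x ∧ c (i + 1) = y) ∨ (∃ i < s, D.Adj (c i) (p 0) ∧ c i = x ∧ p 0 = y) ∨
      (∃ k, k + 1 < m ∧ p k = x ∧ p (k + 1) = y) ∨
      (∃ j < s, D.Adj (p (m - 1)) (c j) ∧ p (m - 1) = x ∧ c j = y) ∨
      ∃ k < m, ∃ l ≤ k, D.Adj (p k) (p l) ∧ p k = x ∧ p l = y := by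
  obtain ⟨i, hi, rfl⟩ | ⟨k, hk, rfl⟩ := h.cover_lt x <;>
    obtain ⟨j, hj, rfl⟩ | ⟨l, hl, rfl⟩ := h.cover_lt y
  · exact Or.inl ⟨i, hi, rfl, (h.cycle.apply_eq (h.cycle.modEq_of_adj i j hxy)).symm⟩
  · obtain ⟨rfl, hi'⟩ := (h.adj_source_iff hl).1 hxy
    exact Or.inr (Or.inl ⟨i, hi, hi', rfl, rfl⟩)
  · obtain ⟨rfl, hj'⟩ := (h.adj_target_iff hk).1 hxy
    exact Or.inr (Or.inr (Or.inr (Or.inl ⟨j, hj, hj', rfl, rfl⟩)))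
  · obtain rfl | ⟨hle, hkl⟩ := (h.adj_ear_iff hl).1 hxy
    · exact Or.inr (Or.inr (Or.inl ⟨k, hl, rfl, rfl⟩))
    · exact Or.inr (Or.inr (Or.inr (Or.inr ⟨k, hk, l, hle, hkl, rfl, rfl⟩)))

theorem source_ne_target (h : IsSpanningEar D s c m p) (hinf : ¬ D.HasInfinitySubdigraph) {i : ℕ}
    (hi : D.Adj (c i) (p 0)) : ¬ D.Adj (p (m - 1)) (c i) := by
  intro hi'
  have hs := h.two_le
  have hcycle := h.cycle.isInnerPath i (k := s - 1) (by omega)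
  rw [show i + (s - 1) + 1 = i + s by omega, h.cycle.periodic] at hcycle
  exact hinf (hasInfinitySubdigraph_of_isInnerPath h.ear.pos (by omega) (h.isInnerPath hi hi')
    hcycle fun k hk _ _ => h.apply_ne hk _)

theorem isInnerPath_segment (h : IsSpanningEar D s c m p) {i d k l : ℕ} (hd : d < s) (hk : k < m)
    (hl : l < m) (hki : D.Adj (p k) (c i)) (hil : D.Adj (c (i + d)) (p l)) :
    IsInnerPath D (p k) (d + 1) (fun t => c (i + t)) (p l) :=
  isInnerPath_of_adj d.succ_pos ((h.cycle.injOn_add i).mono (Set.Iio_subset_Iio hd))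
    (fun _ _ => (h.apply_ne hk _).symm) (fun _ _ => (h.apply_ne hl _).symm) hki
    (fun _ _ => h.cycle.adj _) hil

theorem two_le_length (h : IsSpanningEar D s c m p) (hinf : ¬ D.HasInfinitySubdigraph) {q : ℕ}
    (hq : q + 1 < s) (hsource : D.Adj (c q) (p 0)) (hsource' : D.Adj (c (s - 1)) (p 0))
    (htarget : D.Adj (p (m - 1)) (c 0)) (htarget' : D.Adj (p (m - 1)) (c (q + 1))) : 2 ≤ m := by
  have hm := h.ear.pos
  by_contra hlt
  obtain rfl : m = 1 := by omega
  refine hinf (hasInfinitySubdigraph_of_isInnerPath (a := q + 1) (b := s - 1 - (q + 1) + 1)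
    (Nat.succ_pos _) (Nat.succ_pos _)
    (h.isInnerPath_segment (i := 0) (by omega) hm hm htarget (by rwa [zero_add]))
    (h.isInnerPath_segment (i := q + 1) (by omega) hm hm htarget' ?_)
    fun i hi j hj => h.cycle.apply_ne (by omega) (by omega))
  rwa [show q + 1 + (s - 1 - (q + 1)) = s - 1 by omega]

theorem isThetaDigraph (h : IsSpanningEar D s c m p) {q : ℕ} (hq : 0 < q) (hqs : q < s)
    (hsource : ∀ i < s, D.Adj (c i) (p 0) ↔ i = q)
    (htarget : ∀ j < s, D.Adj (p (m - 1)) (c j) ↔ j = 0)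
    (hback : ∀ k < m, ∀ l ≤ k, ¬ D.Adj (p k) (p l)) : D.IsThetaDigraph := by
  have hclose : c (q + (s - 1 - q) + 1) = c 0 := by
    rw [show q + (s - 1 - q) + 1 = s by omega, h.cycle.periodic.eq]
  have hsplit : c (0 + (q - 1) + 1) = c q := by rw [show 0 + (q - 1) + 1 = q by omega]
  have houter {x : ℕ} (hx : x ≤ s - 1 - q + 1) := hclose ▸ pathWithEnds_segment (f := c) (i := q) hx
  have hinner {x : ℕ} (hx : x ≤ q - 1 + 1) := hsplit ▸ pathWithEnds_segment (f := c) (i := 0) hx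
  refine isThetaDigraph_of_isInnerPath (h.cycle.apply_ne hq (by omega)).symm (Or.inl h.ear.pos)
    (h.isInnerPath ((hsource q hqs).2 rfl) ((htarget 0 (by omega)).2 rfl))
    (hclose ▸ h.cycle.isInnerPath q (by omega)) (hsplit ▸ h.cycle.isInnerPath 0 (by omega))
    (fun k hk _ _ => h.apply_ne hk _) (fun k hk _ _ => h.apply_ne hk _)
    (fun i hi j hj => (h.cycle.apply_ne (by omega) (by omega)).symm) h.exists_adj
    fun x y hxy => ?_
  simp only [isPathArc_iff]
  obtain ⟨i, hi, rfl, rfl⟩ | ⟨i, hi, hadj, rfl, rfl⟩ | ⟨k, hk, rfl, rfl⟩ |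
    ⟨j, hj, hadj, rfl, rfl⟩ | ⟨k, hk, l, hl, hadj, -⟩ := h.adj_cases hxy
  · obtain hlt | ⟨x, rfl⟩ := (lt_or_ge i q).imp_right Nat.exists_eq_add_of_le
    · refine Or.inr (Or.inr ⟨i, by omega, ?_, ?_⟩)
      · rw [hinner (by omega), zero_add]
      · rw [hinner (by omega), zero_add]
    · exact Or.inr (Or.inl ⟨x, by omega, houter (by omega), houter (by omega)⟩)
  · obtain rfl := (hsource i hi).1 hadj
    exact Or.inl ⟨0, m.zero_le, rfl, pathWithEnds_succ h.ear.pos⟩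
  · exact Or.inl ⟨k + 1, hk.le, pathWithEnds_succ (by omega), pathWithEnds_succ hk⟩
  · obtain rfl := (htarget j hj).1 hadj
    obtain ⟨t, rfl⟩ := Nat.exists_eq_add_of_le' h.ear.pos
    exact Or.inl ⟨t + 1, le_rfl, pathWithEnds_succ t.lt_succ_self, pathWithEnds_last⟩
  · exact absurd hadj (hback k hk l hl)

end IsSpanningEar

end Classification

section Labellings

variable {V : Type*} {D : Digraph V} {n : ℕ} {g : ℕ → V} {F : ℕ → ℕ → Prop}

/-- The vertices of `D` are labelled by `0, …, n - 1`, and the arcs of `D` are those of the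
directed cycle `g 0 → ⋯ → g (n - 1) → g 0` and those from `g x` to `g y` with `F x y`. -/
structure IsHamiltonianLabelling (D : Digraph V) (n : ℕ) (g : ℕ → V) (F : ℕ → ℕ → Prop) :
    Prop where
  injOn : Set.InjOn g (Set.Iio n)
  cover : ∀ v, ∃ x < n, g x = v
  adj_iff : ∀ x < n, ∀ y < n,
    D.Adj (g x) (g y) ↔ (y = x + 1 ∨ (x + 1 = n ∧ y = 0)) ∨ F x y

/-- The residue of `x + r` modulo `n`, for `x < n` and `r < n`. -/
def rotateLabel (n r x : ℕ) : ℕ :=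
  if x + r < n then x + r else x + r - n

namespace IsHamiltonianLabelling

theorem rotate (h : IsHamiltonianLabelling D n g F) {r : ℕ} (hr : r < n) :
    IsHamiltonianLabelling D n (fun x => g (rotateLabel n r x))
      fun x y => F (rotateLabel n r x) (rotateLabel n r y) := by
  have hlt : ∀ x < n, rotateLabel n r x < n := by
    intro x hx
    unfold rotateLabel
    split_ifs <;> omega
  refine ⟨fun x hx y hy heq => ?_, fun v => ?_, fun x hx y hy => ?_⟩
  · have hrot := h.injOn (hlt x hx) (hlt y hy) heq
    simp only [Set.mem_Iio] at hx hy
    unfold rotateLabel at hrot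
    split_ifs at hrot <;> omega
  · obtain ⟨t, ht, rfl⟩ := h.cover v
    refine ⟨if r ≤ t then t - r else t + n - r, by split_ifs <;> omega, congrArg g ?_⟩
    unfold rotateLabel
    split_ifs <;> omega
  · rw [h.adj_iff _ (hlt x hx) _ (hlt y hy)]
    refine or_congr_left ?_
    unfold rotateLabel
    split_ifs <;> omega

theorem isomorphic (h : IsHamiltonianLabelling D n g F) {E : Set (ℕ × ℕ)}
    (hE : ∀ x < n, ∀ y < n, (x + 1, y + 1) ∈ E ↔ F x y) :
    D.Isomorphic (Digraph.cycleWithArcs n E) := by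
  have hbij : Function.Bijective fun x : Fin n => g x :=
    ⟨fun x y heq => Fin.ext (h.injOn x.2 y.2 heq), fun v =>
      let ⟨x, hx, hv⟩ := h.cover v
      ⟨⟨x, hx⟩, hv⟩⟩
  refine ⟨RelIso.symm ⟨Equiv.ofBijective _ hbij, fun {x y} => ?_⟩⟩
  have hy := y.2
  refine (h.adj_iff x x.2 y y.2).trans (or_congr ?_ (hE x x.2 y y.2).symm)
  obtain hlt | heq := (Nat.succ_le_of_lt x.2).lt_or_eq
  · rw [Nat.mod_eq_of_lt hlt]
    omega
  · rw [show (x : ℕ) + 1 = n from heq, Nat.mod_self]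
    omega

end IsHamiltonianLabelling

theorem exists_increasing_enumeration {G : ℕ → ℕ → Prop} (hlt : ∀ a b, G a b → a < n)
    (hfun : ∀ a b b', G a b → G a b' → b = b') :
    ∃ (k : ℕ) (t u : ℕ → ℕ), (∀ i < k, G (t i) (u i)) ∧ (∀ i j, i < j → j < k → t i < t j) ∧
      ∀ a b, G a b → ∃ i < k, t i = a ∧ u i = b := by
  have hfin : {a | ∃ b, G a b}.Finite := (Set.finite_Iio n).subset fun a ⟨b, hab⟩ => hlt a b hab
  have hmem (i : ℕ) (hi : i < hfin.toFinset.card) : ∃ b, G (Nat.nth (fun a => ∃ b, G a b) i) b :=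
    Nat.nth_mem_of_lt_card hfin hi
  choose! u hu using hmem
  refine ⟨_, _, u, hu, fun i j hij hj => Nat.nth_lt_nth_of_lt_card hfin hij hj, fun a b hab => ?_⟩
  obtain ⟨i, hi, rfl⟩ := Nat.exists_lt_card_finite_nth_eq hfin ⟨b, hab⟩
  exact ⟨i, hi, rfl, hfun _ _ _ (hu i hi) hab⟩

theorem IsHamiltonianLabelling.isType4 (h : IsHamiltonianLabelling D n g F)
    (hback : ∀ a b, F a b → b < a ∧ a < n) (hfun : ∀ a b b', F a b → F a b' → b = b')
    (hdisj : ∀ a b a' b', F a b → F a' b' → a < a' → a < b') {a b a' b' : ℕ} (hab : F a b)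
    (hab' : F a' b') (hne : a ≠ a') : D.IsType4 := by
  obtain ⟨k, t, u, hmem, hmono, hsurj⟩ :=
    exists_increasing_enumeration (fun a b hab => (hback a b hab).2) hfun
  obtain ⟨i, hi, rfl, -⟩ := hsurj _ _ hab
  obtain ⟨i', hi', rfl, -⟩ := hsurj _ _ hab'
  have hk : 2 ≤ k := by
    by_contra hlt
    exact hne (congrArg t (by omega))
  refine ⟨n, k, fun i => t (i - 1) + 1, fun i => u (i - 1) + 1, hk, Nat.le_add_left 1 _,
    ?_, ?_, ?_, h.isomorphic fun x hx y hy => ⟨?_, fun hxy => ?_⟩⟩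
  · exact (hback _ _ (hmem (k - 1) (by omega))).2
  · intro j hj
    rw [Finset.mem_Icc] at hj
    exact Nat.succ_lt_succ (hback _ _ (hmem (j - 1) (by omega))).1
  · intro j hj
    rw [Finset.mem_Ico] at hj
    exact Nat.succ_lt_succ (hdisj _ _ _ _ (hmem (j - 1) (by omega)) (hmem (j + 1 - 1) (by omega))
      (hmono _ _ (by omega) (by omega)))
  · rintro ⟨j, hj, heq⟩
    rw [Finset.mem_Icc] at hj
    obtain ⟨rfl, rfl⟩ : x = t (j - 1) ∧ y = u (j - 1) := by simpa using heq
    exact hmem _ (by omega)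
  · obtain ⟨j, hj, rfl, rfl⟩ := hsurj _ _ hxy
    exact ⟨j + 1, Finset.mem_Icc.2 (by omega), rfl⟩

end Labellings

section HamiltonianEars

variable {V : Type*} {D : Digraph V} {s m : ℕ} {c p : ℕ → V}

/-- A spanning ear whose source `c (s - 1)` precedes its target `c 0` on the cycle, so that the
ear followed by the cycle is a Hamiltonian cycle of `D`. -/
structure IsHamiltonianEar (D : Digraph V) (s : ℕ) (c : ℕ → V) (m : ℕ) (p : ℕ → V) : Prop
    extends IsSpanningEar D s c m p where
  source_last : D.Adj (c (s - 1)) (p 0)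
  target_zero : D.Adj (p (m - 1)) (c 0)

/-- The labelling of the vertices along the Hamiltonian cycle: first the ear `p` on `m` vertices,
then the cycle `c`. -/
def earLabelling (m : ℕ) (c p : ℕ → V) (x : ℕ) : V :=
  if x < m then p x else c (x - m)

/-- The arcs, in terms of `earLabelling`, outside the Hamiltonian cycle: the last arc of the cycle
`c`, the backward arcs `back` within the ear, the arcs to its first vertex from the cycle vertices
in `src`, and the arcs from its last vertex to the cycle vertices in `tgt`. -/
def earChord (m s : ℕ) (src tgt : ℕ → Prop) (back : ℕ → ℕ → Prop) (x y : ℕ) : Prop :=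
  (x = m + s - 1 ∧ y = m) ∨ (x < m ∧ y ≤ x ∧ back x y) ∨
    (m ≤ x ∧ x + 1 < m + s ∧ y = 0 ∧ src (x - m)) ∨ (x = m - 1 ∧ m < y ∧ tgt (y - m))

theorem IsSpanningEar.injOn_earLabelling (h : IsSpanningEar D s c m p) :
    Set.InjOn (earLabelling m c p) (Set.Iio (m + s)) := by
  intro x hx y hy heq
  simp only [Set.mem_Iio] at hx hy
  unfold earLabelling at heq
  split_ifs at heq with hxm hym hym
  · exact h.ear.injOn hxm hym heq
  · exact absurd heq (h.apply_ne hxm _)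
  · exact absurd heq.symm (h.apply_ne hym _)
  · have := (h.cycle.modEq_of_eq _ _ heq).eq_of_lt_of_lt (by omega) (by omega)
    omega

theorem IsSpanningEar.exists_earLabelling_eq (h : IsSpanningEar D s c m p) (v : V) :
    ∃ x < m + s, earLabelling m c p x = v := by
  obtain ⟨i, hi, rfl⟩ | ⟨k, hk, rfl⟩ := h.cover_lt v
  · exact ⟨m + i, by omega, by simp [earLabelling]⟩
  · exact ⟨k, by omega, if_pos hk⟩

theorem IsHamiltonianEar.isHamiltonianLabelling (h : IsHamiltonianEar D s c m p)
    {src tgt : ℕ → Prop} {back : ℕ → ℕ → Prop}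
    (hsrc : ∀ i, i + 1 < s → (D.Adj (c i) (p 0) ↔ src i))
    (htgt : ∀ j < s, 0 < j → (D.Adj (p (m - 1)) (c j) ↔ tgt j))
    (hback : ∀ k < m, ∀ l ≤ k, D.Adj (p k) (p l) ↔ back k l) :
    IsHamiltonianLabelling D (m + s) (earLabelling m c p) (earChord m s src tgt back) := by
  refine ⟨h.injOn_earLabelling, h.exists_earLabelling_eq, fun x hx y hy => ?_⟩
  have hs := h.two_le
  have hm := h.ear.pos
  unfold earLabelling earChord
  split_ifs with hxm hym hym
  · rw [h.adj_ear_iff hym, and_congr_right fun hle => hback x hxm y hle]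
    grind
  · rw [h.adj_target_iff hxm]
    obtain rfl | hlt := (not_lt.1 hym).eq_or_lt
    · simp only [Nat.sub_self, h.target_zero, and_true]
      grind
    · rw [htgt _ (by omega) (by omega)]
      grind
  · rw [h.adj_source_iff hym]
    obtain hlt | rfl : x + 1 < m + s ∨ x = m + s - 1 := by omega
    · rw [hsrc _ (by omega)]
      grind
    · rw [show m + s - 1 - m = s - 1 by omega]
      simp only [h.source_last, and_true]
      grind
  · rw [h.adj_cycle_iff (by omega) (by omega)]
    omega

theorem IsSpanningEar.target_eq_zero_or_eq_source_succ (h : IsSpanningEar D s c m p)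
    (hcrit : IsBranchCritical D) {q j : ℕ} (hq : D.Adj (c q) (p 0)) (hqs : q + 1 < s)
    (hzero : D.Adj (p (m - 1)) (c 0)) (hadj : D.Adj (p (m - 1)) (c j)) (hj : j < s) :
    j = 0 ∨ j = q + 1 := by
  refine or_iff_not_imp_left.2 fun hj0 => ?_
  have hzero' : D.Adj (p (m - 1)) (c (q + 1 + (s - 1 - q))) := by
    rwa [show q + 1 + (s - 1 - q) = s by omega, h.cycle.periodic.eq]
  obtain ⟨t, rfl⟩ | hle := (lt_or_ge q j).imp_left Nat.exists_eq_add_of_lt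
  · have := h.target_eq_zero hcrit hq (by rwa [add_right_comm]) hzero'
      (show t < s - 1 - q by omega) (by omega)
    omega
  · have hadj' : D.Adj (p (m - 1)) (c (q + 1 + (j + (s - 1 - q)))) := by
      rwa [show q + 1 + (j + (s - 1 - q)) = j + s by omega, h.cycle.periodic]
    have := h.target_eq_zero hcrit hq hzero' hadj' (by omega) (by omega)
    omega

theorem IsSpanningEar.isThetaDigraph_or_exists_isHamiltonianEar (h : IsSpanningEar D s c m p)
    (hcrit : IsBranchCritical D) (hinf : ¬ D.HasInfinitySubdigraph) :
    D.IsThetaDigraph ∨ ∃ c', IsHamiltonianEar D s c' m p := by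
  obtain ⟨j₀, htarget⟩ := h.exists_target
  replace h := h.shift j₀
  rw [← zero_add j₀] at htarget
  generalize hc' : (fun i => c (i + j₀)) = c' at h
  replace htarget : D.Adj (p (m - 1)) (c' 0) := hc' ▸ htarget
  clear hc'
  obtain ⟨q, hqs, hq⟩ := h.exists_source 0
  rw [zero_add] at hq
  refine or_iff_not_imp_right.2 fun hnot => ?_
  have hlast : ∀ i, D.Adj (c' i) (p 0) → i ≠ s - 1 := by
    rintro _ hi rfl
    exact hnot ⟨c', h, hi, htarget⟩
  have hq_lt : q + 1 < s := by
    have := hlast q hq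
    omega
  have hback : ∀ k < m, ∀ l ≤ k, ¬ D.Adj (p k) (p l) := fun k hk l hl hkl =>
    hlast q hq (h.eq_sub_one_of_back hcrit htarget (by rwa [zero_add]) hqs hk hl hkl)
  have hsrc {i i' : ℕ} (hi : D.Adj (c' i) (p 0)) (hi' : D.Adj (c' i') (p 0)) (hs' : i' < s) :
      i' ≤ i := by
    by_contra! hlt
    exact hlast i' hi' (h.source_eq_sub_one hcrit htarget (by rwa [zero_add]) (by rwa [zero_add])
      hlt hs')
  have htgt : ∀ j < s, D.Adj (p (m - 1)) (c' j) → j = 0 := by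
    intro j hj hadj
    refine (h.target_eq_zero_or_eq_source_succ hcrit hq hq_lt htarget hadj hj).resolve_right ?_
    rintro rfl
    refine hnot ⟨fun i => c' (i + (q + 1)), h.shift (q + 1), ?_, by rwa [zero_add]⟩
    rwa [show s - 1 + (q + 1) = q + s by omega, h.cycle.periodic]
  have hq0 : 0 < q := Nat.pos_of_ne_zero fun hq0 => h.source_ne_target hinf hq (hq0 ▸ htarget)
  exact h.isThetaDigraph hq0 hqs
    (fun i hi => ⟨fun hadj => le_antisymm (hsrc hq hadj hi) (hsrc hadj hq hqs), fun e => e ▸ hq⟩)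
    (fun j hj => ⟨htgt j hj, fun e => e ▸ htarget⟩) hback

namespace IsHamiltonianEar

theorem source_iff (h : IsHamiltonianEar D s c m p) (hcrit : IsBranchCritical D) {q : ℕ}
    (hq : D.Adj (c q) (p 0)) (hqs : q + 1 < s) :
    ∀ i, i + 1 < s → (D.Adj (c i) (p 0) ↔ i = q) := by
  have hle {i j : ℕ} (hi : D.Adj (c i) (p 0)) (hj : D.Adj (c j) (p 0)) (hjs : j + 1 < s) :
      j ≤ i := by
    by_contra! hlt
    have := h.source_eq_sub_one hcrit h.target_zero (by rwa [zero_add]) (by rwa [zero_add]) hlt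
      (by omega)
    omega
  exact fun i hi => ⟨fun hadj => le_antisymm (hle hq hadj hi) (hle hadj hq hqs), fun e => e ▸ hq⟩

theorem target_iff (h : IsHamiltonianEar D s c m p) (hcrit : IsBranchCritical D) {a : ℕ}
    (ha : D.Adj (p (m - 1)) (c a)) (hpos : 0 < a) (has : a < s) :
    ∀ j < s, 0 < j → (D.Adj (p (m - 1)) (c j) ↔ j = a) := by
  have hshift (i : ℕ) : c (s - 1 + 1 + i) = c i := by
    rw [Nat.sub_add_cancel h.cycle.pos, add_comm, h.cycle.periodic]
  have hle {i j : ℕ} (hi : D.Adj (p (m - 1)) (c i)) (hj : D.Adj (p (m - 1)) (c j)) (hi0 : 0 < i)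
      (hjs : j < s) : j ≤ i := by
    by_contra! hlt
    have := h.target_eq_zero hcrit h.source_last (by rwa [hshift]) (by rwa [hshift]) hlt hjs
    omega
  exact fun j hj hj0 => ⟨fun hadj => le_antisymm (hle ha hadj hpos hj) (hle hadj ha hj0 has),
    fun e => e ▸ ha⟩

theorem source_pos (h : IsHamiltonianEar D s c m p) (hinf : ¬ D.HasInfinitySubdigraph) {q : ℕ}
    (hq : D.Adj (c q) (p 0)) : 0 < q :=
  Nat.pos_of_ne_zero fun hq0 => h.source_ne_target hinf hq (hq0 ▸ h.target_zero)

theorem target_lt (h : IsHamiltonianEar D s c m p) (hinf : ¬ D.HasInfinitySubdigraph) {a : ℕ}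
    (ha : D.Adj (p (m - 1)) (c a)) (has : a < s) : a + 1 < s := by
  by_contra hle
  obtain rfl : a = s - 1 := by omega
  exact h.source_ne_target hinf h.source_last ha

theorem target_eq_source_succ (h : IsHamiltonianEar D s c m p) (hcrit : IsBranchCritical D)
    {q a : ℕ} (hq : D.Adj (c q) (p 0)) (hqs : q + 1 < s) (ha : D.Adj (p (m - 1)) (c a))
    (hpos : 0 < a) (has : a < s) : a = q + 1 := by
  obtain rfl | heq := h.target_eq_zero_or_eq_source_succ hcrit hq hqs h.target_zero ha has
  exacts [absurd hpos (lt_irrefl 0), heq]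

theorem not_back_of_source (h : IsHamiltonianEar D s c m p) (hcrit : IsBranchCritical D) {q : ℕ}
    (hq : D.Adj (c q) (p 0)) (hqs : q + 1 < s) : ∀ k < m, ∀ l ≤ k, ¬ D.Adj (p k) (p l) := by
  intro k hk l hl hkl
  have := h.eq_sub_one_of_back hcrit h.target_zero (by rwa [zero_add]) (by omega) hk hl hkl
  omega

theorem not_back_of_target (h : IsHamiltonianEar D s c m p) (hcrit : IsBranchCritical D) {a : ℕ}
    (ha : D.Adj (p (m - 1)) (c a)) (hpos : 0 < a) (has : a < s) :
    ∀ k < m, ∀ l ≤ k, ¬ D.Adj (p k) (p l) := by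
  intro k hk l hl hkl
  have hlast : D.Adj (c (a + (s - 1 - a))) (p 0) := by
    rw [show a + (s - 1 - a) = s - 1 by omega]
    exact h.source_last
  have := h.eq_sub_one_of_back hcrit ha hlast (by omega) hk hl hkl
  omega

theorem isType3_of_source (h : IsHamiltonianEar D s c m p) {q : ℕ} (hpos : 0 < q) (hqs : q + 1 < s)
    (hsrc : ∀ i, i + 1 < s → (D.Adj (c i) (p 0) ↔ i = q))
    (htgt : ∀ j < s, 0 < j → ¬ D.Adj (p (m - 1)) (c j))
    (hback : ∀ k < m, ∀ l ≤ k, ¬ D.Adj (p k) (p l)) : D.IsType3 := by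
  have hm := h.ear.pos
  -- The vertex `1` of the Hamiltonian cycle is `c q`.
  refine ⟨m + s, s - q + 1, s - q + 1 + m, by omega, by omega, by omega,
    ((h.isHamiltonianLabelling hsrc (fun j hj hj0 => iff_false_intro (htgt j hj hj0))
      (fun k hk l hl => iff_false_intro (hback k hk l hl))).rotate
      (r := m + q) (by omega)).isomorphic ?_⟩
  simp only [Set.mem_insert_iff, Set.mem_singleton_iff, Prod.mk.injEq]
  grind [rotateLabel, earChord]

theorem isType3_of_target (h : IsHamiltonianEar D s c m p) {a : ℕ} (hpos : 0 < a) (has : a + 1 < s)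
    (hsrc : ∀ i, i + 1 < s → ¬ D.Adj (c i) (p 0))
    (htgt : ∀ j < s, 0 < j → (D.Adj (p (m - 1)) (c j) ↔ j = a))
    (hback : ∀ k < m, ∀ l ≤ k, ¬ D.Adj (p k) (p l)) : D.IsType3 := by
  have hm := h.ear.pos
  -- The vertex `1` of the Hamiltonian cycle is `c (s - 1)`.
  refine ⟨m + s, m + 2, m + a + 2, by omega, by omega, by omega,
    ((h.isHamiltonianLabelling (fun i hi => iff_false_intro (hsrc i hi)) htgt
      (fun k hk l hl => iff_false_intro (hback k hk l hl))).rotate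
      (r := m + s - 1) (by omega)).isomorphic ?_⟩
  simp only [Set.mem_insert_iff, Set.mem_singleton_iff, Prod.mk.injEq]
  grind [rotateLabel, earChord]

theorem isType5 (h : IsHamiltonianEar D s c m p) (hm : 2 ≤ m) {q : ℕ} (hpos : 0 < q)
    (hqs : q + 2 < s) (hsrc : ∀ i, i + 1 < s → (D.Adj (c i) (p 0) ↔ i = q))
    (htgt : ∀ j < s, 0 < j → (D.Adj (p (m - 1)) (c j) ↔ j = q + 1))
    (hback : ∀ k < m, ∀ l ≤ k, ¬ D.Adj (p k) (p l)) : D.IsType5 := by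
  -- The vertex `1` of the Hamiltonian cycle is `c (s - 1)`.
  refine ⟨m + s, m + 2, m + q + 3, by omega, by omega, by omega,
    ((h.isHamiltonianLabelling hsrc htgt
      (fun k hk l hl => iff_false_intro (hback k hk l hl))).rotate
      (r := m + s - 1) (by omega)).isomorphic ?_⟩
  simp only [Set.mem_insert_iff, Set.mem_singleton_iff, Prod.mk.injEq]
  grind [rotateLabel, earChord]

theorem isType4 (h : IsHamiltonianEar D s c m p) (hsimple : D.IsSimple) (hcrit : IsBranchCritical D)
    (hsrc : ∀ i, i + 1 < s → ¬ D.Adj (c i) (p 0))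
    (htgt : ∀ j < s, 0 < j → ¬ D.Adj (p (m - 1)) (c j))
    {k l : ℕ} (hk : k < m) (hl : l ≤ k) (hkl : D.Adj (p k) (p l)) : D.IsType4 := by
  have hs := h.two_le
  have hlabel := h.isHamiltonianLabelling (fun i hi => iff_false_intro (hsrc i hi))
    (fun j hj hj0 => iff_false_intro (htgt j hj hj0)) (fun k _ l _ => Iff.rfl)
  have hchord (a b : ℕ) : earChord m s (fun _ => False) (fun _ => False)
      (fun k l => D.Adj (p k) (p l)) a b ↔
        (a = m + s - 1 ∧ b = m) ∨ (a < m ∧ b ≤ a ∧ D.Adj (p a) (p b)) := by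
    simp only [earChord, and_false, or_false]
  refine hlabel.isType4 ?_ ?_ ?_ ((hchord k l).2 (Or.inr ⟨hk, hl, hkl⟩))
    ((hchord _ _).2 (Or.inl ⟨rfl, rfl⟩)) (by omega)
  · intro a b hab
    obtain ⟨rfl, rfl⟩ | ⟨ham, hba, hadj⟩ := (hchord a b).1 hab
    · omega
    · exact ⟨hba.lt_of_ne fun heq => hsimple _ (heq ▸ hadj), by omega⟩
  · intro a b b' hab hab'
    obtain ⟨ha, hb⟩ | ⟨ham, hba, hadj⟩ := (hchord a b).1 hab <;>
      obtain ⟨ha', hb'⟩ | ⟨ham', hba', hadj'⟩ := (hchord a b').1 hab'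
    any_goals omega
    exact (h.eq_of_back_overlap hcrit hba hadj ham hba' hadj' hba' le_rfl).2
  · intro a b a' b' hab hab' hlt
    obtain ⟨ha, hb⟩ | ⟨ham, hba, hadj⟩ := (hchord a b).1 hab <;>
      obtain ⟨ha', hb'⟩ | ⟨ham', hba', hadj'⟩ := (hchord a' b').1 hab'
    any_goals omega
    by_contra! hle
    exact hlt.ne (h.eq_of_back_overlap hcrit hba hadj ham' hba' hadj' hle hlt.le).1

theorem isThetaDigraph_of_not_chord (h : IsHamiltonianEar D s c m p)
    (hsrc : ∀ i, i + 1 < s → ¬ D.Adj (c i) (p 0))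
    (htgt : ∀ j < s, 0 < j → ¬ D.Adj (p (m - 1)) (c j))
    (hback : ∀ k < m, ∀ l ≤ k, ¬ D.Adj (p k) (p l)) : D.IsThetaDigraph := by
  have hs := h.two_le
  refine h.toIsSpanningEar.isThetaDigraph (q := s - 1) (by omega) (by omega)
    (fun i hi => ⟨fun hadj => ?_, fun e => e ▸ h.source_last⟩)
    (fun j hj => ⟨fun hadj => ?_, fun e => e ▸ h.target_zero⟩) hback
  · by_contra hne
    exact hsrc i (by omega) hadj
  · by_contra hne
    exact htgt j hj (Nat.pos_of_ne_zero hne) hadj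

theorem classification (h : IsHamiltonianEar D s c m p) (hsimple : D.IsSimple)
    (hcrit : IsBranchCritical D) (hinf : ¬ D.HasInfinitySubdigraph) :
    D.IsThetaDigraph ∨ D.IsType3 ∨ D.IsType4 ∨ D.IsType5 := by
  by_cases hsource : ∃ q, q + 1 < s ∧ D.Adj (c q) (p 0) <;>
    by_cases htarget : ∃ a, 0 < a ∧ a < s ∧ D.Adj (p (m - 1)) (c a)
  · obtain ⟨q, hqs, hq⟩ := hsource
    obtain ⟨a, ha0, has, ha⟩ := htarget
    obtain rfl := h.target_eq_source_succ hcrit hq hqs ha ha0 has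
    exact Or.inr (Or.inr (Or.inr (h.isType5
      (h.two_le_length hinf hqs hq h.source_last h.target_zero ha) (h.source_pos hinf hq)
      (h.target_lt hinf ha has) (h.source_iff hcrit hq hqs) (h.target_iff hcrit ha ha0 has)
      (h.not_back_of_source hcrit hq hqs))))
  · obtain ⟨q, hqs, hq⟩ := hsource
    exact Or.inr (Or.inl (h.isType3_of_source (h.source_pos hinf hq) hqs
      (h.source_iff hcrit hq hqs) (fun j hj hj0 hadj => htarget ⟨j, hj0, hj, hadj⟩)
      (h.not_back_of_source hcrit hq hqs)))
  · obtain ⟨a, ha0, has, ha⟩ := htarget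
    exact Or.inr (Or.inl (h.isType3_of_target ha0 (h.target_lt hinf ha has)
      (fun i hi hadj => hsource ⟨i, hi, hadj⟩) (h.target_iff hcrit ha ha0 has)
      (h.not_back_of_target hcrit ha ha0 has)))
  · have hsrc : ∀ i, i + 1 < s → ¬ D.Adj (c i) (p 0) := fun i hi hadj => hsource ⟨i, hi, hadj⟩
    have htgt : ∀ j < s, 0 < j → ¬ D.Adj (p (m - 1)) (c j) := fun j hj hj0 hadj =>
      htarget ⟨j, hj0, hj, hadj⟩
    by_cases hback : ∃ k < m, ∃ l ≤ k, D.Adj (p k) (p l)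
    · obtain ⟨k, hk, l, hl, hkl⟩ := hback
      exact Or.inr (Or.inr (Or.inl (h.isType4 hsimple hcrit hsrc htgt hk hl hkl)))
    · exact Or.inl (h.isThetaDigraph_of_not_chord hsrc htgt fun k hk l hl hkl =>
        hback ⟨k, hk, l, hl, hkl⟩)

end IsHamiltonianEar

end HamiltonianEars

theorem mainTheorem3 {V : Type*} [Fintype V] (D : Digraph V)
    (hsimple : D.IsSimple) (hconn : D.StronglyConnected)
    (hthree : D.complementaritySpectrum.ncard = 3)
    (htheta : D.HasThetaSubdigraph) (hinf : ¬ D.HasInfinitySubdigraph) :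
    D.IsThetaDigraph ∨ D.IsType3 ∨ D.IsType4 ∨ D.IsType5 := by
  obtain ⟨w, a, b, hab, ha, hb⟩ := exists_adj_adj_of_hasThetaSubdigraph htheta
  have : Nontrivial V := ⟨a, b, hab⟩
  have hcrit : IsBranchCritical D := isBranchCritical_of_ncard_eq_three hsimple hconn hthree
  obtain ⟨s, c, hc⟩ := exists_isInducedDicycle (exists_adj_of_stronglyConnected hconn)
  obtain ⟨m, p, hp⟩ :=
    exists_isSpanningEar hsimple hconn hcrit hc (range_ne_univ_of_adj_adj hc hab ha hb)
  obtain htheta | ⟨c', hc'⟩ := hp.isThetaDigraph_or_exists_isHamiltonianEar hcrit hinf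
  · exact Or.inl htheta
  · exact hc'.classification hsimple hcrit hinf
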